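/- Let $M$ be a finite-dimensional smooth manifold (Hausdorff, second countable, without boundary). For a $(1,1)$ tensor field $N:TM\to TM$ with transpose $N^*$, let $(i_N\omega)(X_1,\dots,X_p)=\sum_{i}\omega(X_1,\dots,NX_i,\dots,X_p)$ for a $p$-form $\omega$ (so $i_Nf=0$ on functions) and let $d_N=i_N\circ d-d\circ i_N$. Let $\pi$ be a Poisson tensor on $M$, and let $\pi^\sharp:T^*M\to TM$ be defined by $\langle\beta,\pi^\sharp\alpha\rangle=\pi(\alpha,\beta)$. For 1-forms put $$[\alpha,\beta]_\pi=L_{\pi^\sharp\alpha}\beta-L_{\pi^\sharp\beta}\alpha-d\langle\beta,\pi^\sharp\alpha\rangle,$$ and extend $[\cdot,\cdot]_\pi$ to all forms as the Koszul bracket, i.e. the unique extension such that, for a $q$-form $\eta$, a $q'$-form $\eta'$ and any form $\eta''$, $[\eta,\eta']_\pi$ is a $(q+q'-1)$-form, $[\eta,\eta']_\pi=-(-1)^{(q-1)(q'-1)}[\eta',\eta]_\pi$, $[\alpha,f]_\pi=\langle df,\pi^\sharp\alpha\rangle$ for 1-forms $\alpha$ and functions $f$, and $[\eta,\eta'\wedge\eta'']_\pi=[\eta,\eta']_\pi\wedge\eta''+(-1)^{(q-1)q'}\eta'\wedge[\eta,\eta'']_\pi$.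 Explicitly, $[\eta,\eta']_\pi=(-1)^q\big(\partial(\eta\wedge\eta')-\partial\eta\wedge\eta'-(-1)^q\eta\wedge\partial\eta'\big)$ with $\partial=i_\pi\circ d-d\circ i_\pi$, where $i_\pi$ is the contraction with $\pi$, normalized by $i_\pi(\alpha\wedge\beta)=\pi(\alpha,\beta)$. Let $N$ be a smooth $(1,1)$ tensor field compatible with $\pi$, that is, $N\pi^\sharp=\pi^\sharp N^*$ and $$(L_{\pi^\sharp\alpha}N)X-\pi^\sharp L_X(N^*\alpha)+\pi^\sharp L_{NX}\alpha=0$$ for all 1-forms $\alpha$ and vector fields $X$. Let $\alpha,\beta,\gamma$ be smooth 1-forms on $M$ with $$d_N\alpha=\alpha\wedge\gamma,\qquad d_N\beta=\beta\wedge\gamma .$$ Set $\delta=\beta+\tfrac12[\beta,\alpha]_\pi$ and $\Omega=\alpha\wedge\delta$. Then $$d_N\Omega+\tfrac12[\Omega,\Omega]_\pi=\alpha\wedge\epsilon,$$ where $$\epsilon=2\gamma\wedge\beta+\tfrac32\,\gamma\wedge[\beta,\alpha]_\pi+\tfrac12\,\beta\wedge[\alpha,\gamma]_\pi+[\delta,\alpha]_\pi\wedge\delta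 .$$ -/

import Mathlib

set_option maxSynthPendingDepth 3

open scoped Manifold ContDiff

noncomputable section

namespace PoissonGeom

/-! ### Multilinear algebra on a real topological vector space -/

section Algebra

variable {V : Type*} [AddCommGroup V] [Module ℝ V] [TopologicalSpace V]

/-- Wedge product of alternating forms, with the normalization
`(θ ∧ η)(v₁, …, v_{p+q}) =
  (1 / (p! q!)) ∑_σ sign σ • θ(v_{σ 1}, …, v_{σ p}) η(v_{σ (p+1)}, …, v_{σ (p+q)})`. -/
def wedgeAlt {p q : ℕ} (θ : V [⋀^Fin p]→L[ℝ] ℝ) (η : V [⋀^Fin q]→L[ℝ] ℝ) :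
    V [⋀^Fin (p + q)]→L[ℝ] ℝ :=
  ((p.factorial * q.factorial : ℝ)⁻¹) •
    ContinuousMultilinearMap.alternatization
      { toMultilinearMap :=
          (LinearMap.mul' ℝ ℝ).compMultilinearMap
            ((MultilinearMap.domCoprod θ.toMultilinearMap η.toMultilinearMap).domDomCongr
              finSumFinEquiv)
        cont := by
          change Continuous fun v : Fin (p + q) → V =>
            θ (fun i => v (Fin.castAdd q i)) * η (fun j => v (Fin.natAdd p j))
          exact (θ.cont.comp (by fun_prop)).mul (η.cont.comp (by fun_prop)) }

theorem wedgeAlt_apply {p q : ℕ} (θ : V [⋀^Fin p]→L[ℝ] ℝ) (η : V [⋀^Fin q]→L[ℝ] ℝ)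
    (v : Fin (p + q) → V) :
    wedgeAlt θ η v = ((p.factorial * q.factorial : ℝ)⁻¹) *
      ∑ σ : Equiv.Perm (Fin (p + q)), (Equiv.Perm.sign σ : ℤ) •
        (θ (fun i => v (σ (Fin.castAdd q i))) * η (fun j => v (σ (Fin.natAdd p j)))) := by
  simp only [wedgeAlt, ContinuousAlternatingMap.smul_apply,
    ContinuousMultilinearMap.alternatization_apply_apply, smul_eq_mul]
  rfl

/-- Interior product `(i_v θ)(v₁, …, v_k) = θ(v, v₁, …, v_k)`. -/
def interiorAlt {k : ℕ} (v : V) (θ : V [⋀^Fin (k + 1)]→L[ℝ] ℝ) : V [⋀^Fin k]→L[ℝ] ℝ :=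
  { AlternatingMap.curryLeft θ.toAlternatingMap v with
    cont := by
      change Continuous fun m : Fin k → V => θ (Matrix.vecCons v m)
      exact θ.cont.comp (by fun_prop) }

theorem interiorAlt_apply {k : ℕ} (v : V) (θ : V [⋀^Fin (k + 1)]→L[ℝ] ℝ) (m : Fin k → V) :
    interiorAlt v θ m = θ (Matrix.vecCons v m) := rfl

/-- `(i_A θ)(v₁, …, v_k) = ∑ i, θ(v₁, …, A vᵢ, …, v_k)` for an endomorphism `A`
(zero for `k = 0`). -/
def insertEndAlt {k : ℕ} (A : V →L[ℝ] V) (θ : V [⋀^Fin k]→L[ℝ] ℝ) : V [⋀^Fin k]→L[ℝ] ℝ :=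
  { toContinuousMultilinearMap :=
      ∑ i : Fin k, θ.toContinuousMultilinearMap.compContinuousLinearMap
        fun j => if j = i then A else ContinuousLinearMap.id ℝ V
    map_eq_zero_of_eq' := by
      intro v a b hab hne
      have key : ∀ i : Fin k, (θ.toContinuousMultilinearMap.compContinuousLinearMap
          fun j => if j = i then A else ContinuousLinearMap.id ℝ V) v =
          θ (Function.update v i (A (v i))) := by
        intro i
        refine congrArg θ (funext fun j => ?_)
        by_cases h : j = i
        · subst h; simp
        · simp [h]
      change (∑ i : Fin k, θ.toContinuousMultilinearMap.compContinuousLinearMap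
        fun j => if j = i then A else ContinuousLinearMap.id ℝ V) v = 0
      rw [sum_apply, Finset.sum_congr rfl fun i _ => key i,
        Finset.sum_eq_add a b hne]
      · have hsw : Function.update v b (A (v b)) =
            Function.update v a (A (v a)) ∘ Equiv.swap a b := by
          funext j
          by_cases hja : j = a
          · subst hja
            simp [hne, hne.symm, hab]
          · by_cases hjb : j = b
            · subst hjb
              simp [hab]
            · simp [Equiv.swap_apply_of_ne_of_ne hja hjb, hja, hjb]
        have h := θ.toAlternatingMap.map_swap (Function.update v a (A (v a))) hne
        rw [hsw]
        exact (congrArg (θ (Function.update v a (A (v a))) + ·) h).trans (add_neg_cancel _)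
      · intro c _ hc
        exact θ.map_eq_zero_of_eq _ (i := a) (j := b)
          (by simp [hc.1.symm, hc.2.symm, hab]) hne
      · simp
      · simp }

theorem insertEndAlt_apply {k : ℕ} (A : V →L[ℝ] V) (θ : V [⋀^Fin k]→L[ℝ] ℝ) (v : Fin k → V) :
    insertEndAlt A θ v = ∑ i, θ (Function.update v i (A (v i))) := by
  change (∑ i : Fin k, θ.toContinuousMultilinearMap.compContinuousLinearMap
    fun j => if j = i then A else ContinuousLinearMap.id ℝ V) v = _
  rw [sum_apply]
  refine Finset.sum_congr rfl fun i _ => congrArg θ (funext fun j => ?_)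
  by_cases h : j = i
  · subst h; simp
  · simp [h]

variable [FiniteDimensional ℝ V] [IsTopologicalAddGroup V] [ContinuousSMul ℝ V] [T2Space V]

/-- For a bilinear form `P` on the dual of `V`, the vector `P♯ a` determined by
`⟨b, P♯ a⟩ = P(a, b)` for all covectors `b`. -/
def sharpVec (P : (V →L[ℝ] ℝ) →L[ℝ] (V →L[ℝ] ℝ) →L[ℝ] ℝ) (a : V →L[ℝ] ℝ) : V :=
  (Module.evalEquiv ℝ V).symm
    ((P a).toLinearMap ∘ₗ (LinearMap.toContinuousLinearMap (𝕜 := ℝ) (E := V) (F' := ℝ)).toLinearMap)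

theorem apply_sharpVec (P : (V →L[ℝ] ℝ) →L[ℝ] (V →L[ℝ] ℝ) →L[ℝ] ℝ) (a b : V →L[ℝ] ℝ) :
    b (sharpVec P a) = P a b := by
  exact Module.apply_evalEquiv_symm_apply (R := ℝ) (M := V) b.toLinearMap
    ((P a).toLinearMap ∘ₗ
      (LinearMap.toContinuousLinearMap (𝕜 := ℝ) (E := V) (F' := ℝ)).toLinearMap)

/-- Contraction of a form with a bivector, `i_P θ = ½ ∑ᵢⱼ P(eⁱ, eʲ) θ(eᵢ, eⱼ, …)`; here
`∑ⱼ P(eⁱ, eʲ) eⱼ = P♯ eⁱ`, where `eᵢ` is a basis of `V` and `eⁱ` the dual basis. In particular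
`i_P (a ∧ b) = P(a, b)`. -/
def contractAlt {k : ℕ} (P : (V →L[ℝ] ℝ) →L[ℝ] (V →L[ℝ] ℝ) →L[ℝ] ℝ)
    (θ : V [⋀^Fin (k + 2)]→L[ℝ] ℝ) : V [⋀^Fin k]→L[ℝ] ℝ :=
  (1 / 2 : ℝ) • ∑ i, interiorAlt
    (sharpVec P (LinearMap.toContinuousLinearMap ((Module.finBasis ℝ V).coord i)))
    (interiorAlt (Module.finBasis ℝ V i) θ)

end Algebra

/-! ### Tensor fields on a smooth manifold `M` modelled on a finite-dimensional space `E`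

All fields are families indexed by the points of `M`; smoothness is a separate predicate. -/

section Fields

variable (E : Type*) [NormedAddCommGroup E] [NormedSpace ℝ E]
variable (M : Type*) [TopologicalSpace M] [ChartedSpace E M]

/-- Differential `k`-forms on `M`. -/
abbrev Form (k : ℕ) : Type _ := ∀ x : M, (TangentSpace 𝓘(ℝ, E) x) [⋀^Fin k]→L[ℝ] ℝ

/-- Vector fields on `M`. -/
abbrev VField : Type _ := ∀ x : M, TangentSpace 𝓘(ℝ, E) x

/-- `(1,1)` tensor fields on `M`, as endomorphisms of the tangent spaces. -/
abbrev EndField : Type _ := ∀ x : M, TangentSpace 𝓘(ℝ, E) x →L[ℝ] TangentSpace 𝓘(ℝ, E) x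

/-- Contravariant 2-tensor fields on `M`, as bilinear forms on the cotangent spaces. -/
abbrev BiField : Type _ := ∀ x : M,
  (TangentSpace 𝓘(ℝ, E) x →L[ℝ] ℝ) →L[ℝ] (TangentSpace 𝓘(ℝ, E) x →L[ℝ] ℝ) →L[ℝ] ℝ

variable {E M}

/-- The value at `x` of a 1-form, as a covector. -/
def covector (a : Form E M 1) (x : M) : TangentSpace 𝓘(ℝ, E) x →L[ℝ] ℝ :=
  (ContinuousAlternatingMap.ofSubsingleton ℝ (TangentSpace 𝓘(ℝ, E) x) ℝ (0 : Fin 1)).symm (a x)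

/-- The expression of a form in the chart at `x₀`: its pullback by the inverse of the chart. -/
def chartForm {k : ℕ} (θ : Form E M k) (x₀ : M) (y : E) : E [⋀^Fin k]→L[ℝ] ℝ :=
  (θ ((extChartAt 𝓘(ℝ, E) x₀).symm y)).compContinuousLinearMap
    (mfderiv 𝓘(ℝ, E) 𝓘(ℝ, E) (extChartAt 𝓘(ℝ, E) x₀).symm y)

/-- A form is smooth if its expressions in charts are. -/
def SmoothForm {k : ℕ} (θ : Form E M k) : Prop :=
  ∀ x₀ : M, ContDiffOn ℝ ∞ (chartForm θ x₀) (extChartAt 𝓘(ℝ, E) x₀).target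

/-- Exterior derivative, computed at `x` in the chart at `x`. -/
def extD {k : ℕ} (θ : Form E M k) : Form E M (k + 1) := fun x =>
  (extDeriv (chartForm θ x) (extChartAt 𝓘(ℝ, E) x x)).compContinuousLinearMap
    (mfderiv 𝓘(ℝ, E) 𝓘(ℝ, E) (extChartAt 𝓘(ℝ, E) x) x)

/-- Wedge product of forms. -/
def wedge {p q : ℕ} (θ : Form E M p) (η : Form E M q) : Form E M (p + q) :=
  fun x => wedgeAlt (θ x) (η x)

infixr:75 " ⋏ " => wedge

/-- Interior product of a form with a vector field. -/
def interiorForm {k : ℕ} (X : VField E M) (θ : Form E M (k + 1)) : Form E M k :=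
  fun x => interiorAlt (X x) (θ x)

/-- Lie derivative `L_X θ = i_X dθ + d i_X θ` of a form of positive degree. -/
def lieForm {k : ℕ} (X : VField E M) (θ : Form E M (k + 1)) : Form E M (k + 1) :=
  interiorForm X (extD θ) + extD (interiorForm X θ)

/-- `N X`. -/
def EndField.app (N : EndField E M) (X : VField E M) : VField E M := fun x => N x (X x)

/-- `N^* a = a ∘ N`. -/
def EndField.transpose (N : EndField E M) (a : Form E M 1) : Form E M 1 :=
  fun x => (a x).compContinuousLinearMap (N x)

/-- `i_N`. -/
def insertEnd {k : ℕ} (N : EndField E M) (θ : Form E M k) : Form E M k :=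
  fun x => insertEndAlt (N x) (θ x)

/-- `d_N = i_N ∘ d - d ∘ i_N`. -/
def dN {k : ℕ} (N : EndField E M) (θ : Form E M k) : Form E M (k + 1) :=
  insertEnd N (extD θ) - extD (insertEnd N θ)

def SmoothVField [IsManifold 𝓘(ℝ, E) ∞ M] (X : VField E M) : Prop :=
  ContMDiff 𝓘(ℝ, E) (𝓘(ℝ, E).prod 𝓘(ℝ, E)) ∞
    (fun x => (Bundle.TotalSpace.mk' E x (X x) : TangentBundle 𝓘(ℝ, E) M))

def SmoothEndField [IsManifold 𝓘(ℝ, E) ∞ M] (N : EndField E M) : Prop :=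
  ContMDiff 𝓘(ℝ, E) (𝓘(ℝ, E).prod 𝓘(ℝ, E →L[ℝ] E)) ∞
    (fun x => Bundle.TotalSpace.mk' (E →L[ℝ] E)
      (E := fun x : M => TangentSpace 𝓘(ℝ, E) x →L[ℝ] TangentSpace 𝓘(ℝ, E) x) x (N x))

def SmoothBiField [IsManifold 𝓘(ℝ, E) ∞ M] (P : BiField E M) : Prop :=
  ContMDiff 𝓘(ℝ, E) (𝓘(ℝ, E).prod 𝓘(ℝ, (E →L[ℝ] ℝ) →L[ℝ] (E →L[ℝ] ℝ) →L[ℝ] ℝ)) ∞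
    (fun x => Bundle.TotalSpace.mk' ((E →L[ℝ] ℝ) →L[ℝ] (E →L[ℝ] ℝ) →L[ℝ] ℝ)
      (E := fun x : M => (TangentSpace 𝓘(ℝ, E) x →L[ℝ] ℝ) →L[ℝ]
        (TangentSpace 𝓘(ℝ, E) x →L[ℝ] ℝ) →L[ℝ] ℝ) x (P x))

/-- `{f, g} = P(df, dg)`. -/
def poissonBracket (P : BiField E M) (f g : M → ℝ) : M → ℝ :=
  fun x => P x (mvfderiv 𝓘(ℝ, E) f x) (mvfderiv 𝓘(ℝ, E) g x)

/-- A Poisson tensor: a smooth bivector field (a skew-symmetric contravariant 2-tensor field) whose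
bracket on smooth functions satisfies the Jacobi identity. -/
structure IsPoisson [IsManifold 𝓘(ℝ, E) ∞ M] (P : BiField E M) : Prop where
  smooth : SmoothBiField P
  skew : ∀ x a b, P x a b = -P x b a
  jacobi : ∀ f g h : M → ℝ, ContMDiff 𝓘(ℝ, E) 𝓘(ℝ, ℝ) ∞ f → ContMDiff 𝓘(ℝ, E) 𝓘(ℝ, ℝ) ∞ g →
    ContMDiff 𝓘(ℝ, E) 𝓘(ℝ, ℝ) ∞ h →
    poissonBracket P f (poissonBracket P g h) + poissonBracket P g (poissonBracket P h f) +
      poissonBracket P h (poissonBracket P f g) = 0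

variable [FiniteDimensional ℝ E]

/-- The vector field `P♯ a`, with `⟨b, P♯ a⟩ = P(a, b)`. -/
def sharp (P : BiField E M) (a : Form E M 1) : VField E M := fun x =>
  haveI : FiniteDimensional ℝ (TangentSpace 𝓘(ℝ, E) x) := inferInstanceAs (FiniteDimensional ℝ E)
  haveI : T2Space (TangentSpace 𝓘(ℝ, E) x) := inferInstanceAs (T2Space E)
  sharpVec (P x) (covector a x)

/-- Compatibility of a bivector field `P` with a `(1,1)` tensor field `N`:
`N P♯ = P♯ N^*`, and `(L_{P♯ a} N) X - P♯ (L_X (N^* a)) + P♯ (L_{N X} a) = 0`, where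
`(L_Y N) X = [Y, N X] - N [Y, X]`. -/
structure Compatible [IsManifold 𝓘(ℝ, E) ∞ M] (P : BiField E M) (N : EndField E M) : Prop where
  comm : ∀ a : Form E M 1, N.app (sharp P a) = sharp P (N.transpose a)
  lie : ∀ (a : Form E M 1) (X : VField E M), SmoothForm a → SmoothVField X →
    (VectorField.mlieBracket 𝓘(ℝ, E) (sharp P a) (N.app X) -
        N.app (VectorField.mlieBracket 𝓘(ℝ, E) (sharp P a) X)) -
      sharp P (lieForm X (N.transpose a)) + sharp P (lieForm (N.app X) a) = 0

/-- The bracket of 1-forms `[a, b]_P = L_{P♯ a} b - L_{P♯ b} a - d⟨b, P♯ a⟩`. -/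
def koszul₁ (P : BiField E M) (a b : Form E M 1) : Form E M 1 :=
  lieForm (sharp P a) b - lieForm (sharp P b) a - extD (interiorForm (sharp P a) b)

/-- Contraction `i_P` of a form with a bivector field. -/
def contract {k : ℕ} (P : BiField E M) (θ : Form E M (k + 2)) : Form E M k := fun x =>
  haveI : FiniteDimensional ℝ (TangentSpace 𝓘(ℝ, E) x) := inferInstanceAs (FiniteDimensional ℝ E)
  haveI : T2Space (TangentSpace 𝓘(ℝ, E) x) := inferInstanceAs (T2Space E)
  contractAlt (P x) (θ x)

/-- The Koszul differential `∂_P = i_P ∘ d - d ∘ i_P`, of degree `-1` (`i_P` vanishes on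
1-forms). -/
def koszulDiff (P : BiField E M) : {k : ℕ} → Form E M (k + 1) → Form E M k
  | 0, θ => contract P (extD θ)
  | _ + 1, θ => contract P (extD θ) - extD (contract P θ)

/-- A form of degree `m` as a form of degree `n = m`. -/
def castForm {m n : ℕ} (h : m = n) (θ : Form E M m) : Form E M n := h ▸ θ

/-- The Koszul bracket of forms of positive degrees `p + 1` and `q + 1`,
`[θ, η]_P = (-1)^(p+1) (∂(θ ∧ η) - ∂θ ∧ η - (-1)^(p+1) θ ∧ ∂η)` with `∂ = ∂_P`.
This is Koszul's formula for the unique extension of the bracket of 1-forms to a graded Lie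
bracket on all forms such that `[a, f]_P = ⟨df, P♯ a⟩` for a 1-form `a` and a function `f`,
`[θ, η]_P = -(-1)^((|θ|-1)(|η|-1)) [η, θ]_P`, and
`[θ, η ∧ ζ]_P = [θ, η]_P ∧ ζ + (-1)^((|θ|-1)|η|) η ∧ [θ, ζ]_P`. -/
def koszul {p q : ℕ} (P : BiField E M) (θ : Form E M (p + 1)) (η : Form E M (q + 1)) :
    Form E M (p + 1 + q) :=
  (-1 : ℝ) ^ (p + 1) • (koszulDiff P (k := p + 1 + q) (wedge (p := p + 1) (q := q + 1) θ η)
    - castForm (m := p + (q + 1)) (by omega) (koszulDiff P θ ⋏ η)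
    - (-1 : ℝ) ^ (p + 1) • (θ ⋏ koszulDiff P η))

end Fields

end PoissonGeom

end

open PoissonGeom

noncomputable section

namespace PoissonGeom

open Filter Topology

/-! ### Wedge products in low degrees. -/

section Algebra

variable {V : Type*} [AddCommGroup V] [Module ℝ V] [TopologicalSpace V]

/-! Write `κ = [β, α]`, so that `δ = β + κ/2`. The left-hand side splits into two independent
computations.

Since `i_N` and `d` are derivations of the wedge product, so is `d_N` (`dN_wedge_one_one`), and `d_N
Ω = α ∧ γ ∧ δ - α ∧ d_N δ`. What is needed is `d_N κ`. Compatibility makes `d_N` a derivation of the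
Koszul bracket, so one expects `d_N κ = [β ∧ γ, α] + [β, α ∧ γ] = 2 κ ∧ γ + α ∧ [β, γ] - β ∧ [α,
γ]`. This is `dN_koszul₁`. After wedging with `α` the term `α ∧ [β, γ]` disappears, and the first
three terms of `ε` remain.

For the quadratic term, `Ω ∧ Ω = 0` reduces Koszul's formula to `½ [Ω, Ω] = -∂Ω ∧ Ω`. By
`koszulDiff_wedge_one_one`, `∂(α ∧ δ)` is `[δ, α]` up to multiples of `α` and `δ`, which `Ω` kills.
What is left is `α ∧ [δ, α] ∧ δ` (`koszul_self_of_decomposable`).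

The formula for `d_N κ` is checked in coordinates. `flatDN_flatBracket` proves it on a normed space
from the differentiated equations for `d_N α` and `d_N β` and the differentiated compatibility
condition. The passage to `M` rests on `chartForm_extD` (the exterior derivative may be taken in any
chart) and on `Compatible.eventually_flatCompatibleAt`, where cutoff functions turn the condition on
global fields into one on constant covectors and vectors. -/

/-- A continuous alternating form in one variable, as a covector. -/
def toCov : (V [⋀^Fin 1]→L[ℝ] ℝ) → (V →L[ℝ] ℝ) :=
  (ContinuousAlternatingMap.ofSubsingleton ℝ V ℝ (0 : Fin 1)).symm

theorem toCov_apply (a : V [⋀^Fin 1]→L[ℝ] ℝ) (v : V) : toCov a v = a ![v] := by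
  simp only [toCov]
  change a _ = _
  congr 1
  ext i
  fin_cases i
  rfl

theorem apply_eq_toCov (a : V [⋀^Fin 1]→L[ℝ] ℝ) (v : Fin 1 → V) : a v = toCov a (v 0) := by
  rw [toCov_apply]
  congr 1
  ext i
  fin_cases i
  rfl

theorem wedgeAlt_one_one (a b : V [⋀^Fin 1]→L[ℝ] ℝ) (v : Fin (1 + 1) → V) :
    wedgeAlt a b v = toCov a (v 0) * toCov b (v 1) - toCov a (v 1) * toCov b (v 0) := by
  rw [wedgeAlt_apply]
  have : (Finset.univ : Finset (Equiv.Perm (Fin (1 + 1)))) = {1, Equiv.swap 0 1} := by decide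
  rw [this, Finset.sum_insert (by decide), Finset.sum_singleton]
  simp only [apply_eq_toCov]
  simp [Fin.castAdd, Fin.natAdd]
  ring

theorem univ_perm_fin_three : (Finset.univ : Finset (Equiv.Perm (Fin 3))) =
    {1, Equiv.swap 0 1, Equiv.swap 0 2, Equiv.swap 1 2, Equiv.swap 0 1 * Equiv.swap 1 2,
      Equiv.swap 1 2 * Equiv.swap 0 1} := by decide

theorem alt_two_swap (θ : V [⋀^Fin 2]→L[ℝ] ℝ) (u v : V) : θ ![u, v] = - θ ![v, u] := by
  have := θ.toAlternatingMap.map_swap ![v, u] (i := 0) (j := 1) (by decide)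
  simp only [ContinuousAlternatingMap.coe_toAlternatingMap] at this
  rw [← this]
  congr 1
  ext i
  fin_cases i <;> rfl

/-- Permutations that differ in the order of the two arguments of `θ` contribute equally, which
cancels the factor `1 / 2!` and leaves the cyclic sum. -/
theorem wedgeAlt_two_one (θ : V [⋀^Fin 2]→L[ℝ] ℝ) (b : V [⋀^Fin 1]→L[ℝ] ℝ)
    (v : Fin (2 + 1) → V) :
    wedgeAlt θ b v = θ ![v 0, v 1] * toCov b (v 2) + θ ![v 1, v 2] * toCov b (v 0)
      + θ ![v 2, v 0] * toCov b (v 1) := by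
  rw [wedgeAlt_apply, univ_perm_fin_three]
  have h : ∀ σ : Equiv.Perm (Fin 3), θ (fun i => v (σ (Fin.castAdd 1 i))) * b (fun i => v (σ (Fin.natAdd 2 i))) =
      θ ![v (σ 0), v (σ 1)] * toCov b (v (σ 2)) := fun σ => by
    rw [apply_eq_toCov b]; congr 2; ext i; fin_cases i <;> rfl
  simp only [h]
  rw [Finset.sum_insert (by decide), Finset.sum_insert (by decide), Finset.sum_insert (by decide),
    Finset.sum_insert (by decide), Finset.sum_insert (by decide), Finset.sum_singleton]
  have s1 : Equiv.swap (0 : Fin 3) 1 2 = 2 := by decide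
  have s2 : Equiv.swap (0 : Fin 3) 2 1 = 1 := by decide
  have s3 : Equiv.swap (1 : Fin 3) 2 0 = 0 := by decide
  simp [s1, s2, s3]
  rw [alt_two_swap θ (v 1) (v 0), alt_two_swap θ (v 2) (v 1), alt_two_swap θ (v 0) (v 2)]
  ring

theorem wedgeAlt_one_two (b : V [⋀^Fin 1]→L[ℝ] ℝ) (θ : V [⋀^Fin 2]→L[ℝ] ℝ)
    (v : Fin (1 + 2) → V) :
    wedgeAlt b θ v = toCov b (v 0) * θ ![v 1, v 2] + toCov b (v 1) * θ ![v 2, v 0]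
      + toCov b (v 2) * θ ![v 0, v 1] := by
  rw [wedgeAlt_apply, univ_perm_fin_three]
  have h : ∀ σ : Equiv.Perm (Fin 3), b (fun i => v (σ (Fin.castAdd 2 i))) * θ (fun i => v (σ (Fin.natAdd 1 i))) =
      toCov b (v (σ 0)) * θ ![v (σ 1), v (σ 2)] := fun σ => by
    rw [apply_eq_toCov b]; congr 2; ext i; fin_cases i <;> rfl
  simp only [h]
  rw [Finset.sum_insert (by decide), Finset.sum_insert (by decide), Finset.sum_insert (by decide),
    Finset.sum_insert (by decide), Finset.sum_insert (by decide), Finset.sum_singleton]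
  have s1 : Equiv.swap (0 : Fin 3) 1 2 = 2 := by decide
  have s2 : Equiv.swap (0 : Fin 3) 2 1 = 1 := by decide
  have s3 : Equiv.swap (1 : Fin 3) 2 0 = 0 := by decide
  simp [s1, s2, s3]
  rw [alt_two_swap θ (v 1) (v 0), alt_two_swap θ (v 2) (v 1), alt_two_swap θ (v 0) (v 2)]
  ring

theorem wedgeAlt_zero_one (f : V [⋀^Fin 0]→L[ℝ] ℝ) (b : V [⋀^Fin 1]→L[ℝ] ℝ)
    (v : Fin (0 + 1) → V) : wedgeAlt f b v = f ![] * toCov b (v 0) := by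
  rw [wedgeAlt_apply]
  have : (Finset.univ : Finset (Equiv.Perm (Fin (0 + 1)))) = {1} := by decide
  rw [this, Finset.sum_singleton, apply_eq_toCov b]
  have h : ∀ w : Fin 0 → V, w = ![] := fun w => Subsingleton.elim _ _
  rw [h (fun i => _)]
  simp

/-- The square under the wedge product of a decomposable 2-form vanishes. -/
theorem wedgeAlt_self_of_decomposable (a d : V [⋀^Fin 1]→L[ℝ] ℝ) :
    wedgeAlt (wedgeAlt a d) (wedgeAlt a d) = 0 := by
  ext v
  rw [wedgeAlt_apply]
  -- A signed sum over permutations vanishes when the summand is invariant under right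
  -- multiplication by an odd `τ`.
  have hs : ∀ F : Equiv.Perm (Fin (1 + 1 + (1 + 1))) → ℝ, ∀ τ : Equiv.Perm (Fin (1 + 1 + (1 + 1))),
      Equiv.Perm.sign τ = -1 → (∀ σ, F (σ * τ) = F σ) →
      ∑ σ, (Equiv.Perm.sign σ : ℤ) • F σ = 0 := fun F τ hτ hF => by
    have h : ∑ σ, (Equiv.Perm.sign σ : ℤ) • F σ =
        ∑ σ, (Equiv.Perm.sign (σ * τ) : ℤ) • F (σ * τ) :=
      (Fintype.sum_equiv (Equiv.mulRight τ) _ _ fun σ => rfl).symm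
    simp only [hF, Equiv.Perm.sign_mul, hτ] at h
    simp only [mul_neg, mul_one, Units.val_neg, neg_smul, Finset.sum_neg_distrib] at h
    linarith
  have h : ∀ σ : Equiv.Perm (Fin (1 + 1 + (1 + 1))),
      wedgeAlt a d (fun i => v (σ (Fin.castAdd (1 + 1) i))) *
        wedgeAlt a d (fun i => v (σ (Fin.natAdd (1 + 1) i))) =
      toCov a (v (σ 0)) * toCov d (v (σ 1)) * toCov a (v (σ 2)) * toCov d (v (σ 3))
      - toCov a (v (σ 0)) * toCov d (v (σ 1)) * toCov a (v (σ 3)) * toCov d (v (σ 2))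
      - toCov a (v (σ 1)) * toCov d (v (σ 0)) * toCov a (v (σ 2)) * toCov d (v (σ 3))
      + toCov a (v (σ 1)) * toCov d (v (σ 0)) * toCov a (v (σ 3)) * toCov d (v (σ 2)) := by
    intro σ
    rw [wedgeAlt_one_one, wedgeAlt_one_one]
    change (toCov a (v (σ 0)) * toCov d (v (σ 1)) - toCov a (v (σ 1)) * toCov d (v (σ 0))) *
      (toCov a (v (σ 2)) * toCov d (v (σ 3)) - toCov a (v (σ 3)) * toCov d (v (σ 2))) = _
    ring
  refine mul_eq_zero_of_right _ ?_
  simp only [h, smul_add, smul_sub, Finset.sum_add_distrib, Finset.sum_sub_distrib]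
  -- In each of the four products `a` occurs twice; the transposition exchanges the two slots of
  -- `a`.
  rw [hs _ (Equiv.swap 0 2) (by decide), hs _ (Equiv.swap 0 3) (by decide),
    hs _ (Equiv.swap 1 2) (by decide), hs _ (Equiv.swap 1 3) (by decide)]
  · simp
  all_goals
    intro σ
    simp only [Equiv.Perm.mul_apply]
  · rw [show Equiv.swap (1 : Fin (1 + 1 + (1 + 1))) 3 1 = 3 by decide,
      show Equiv.swap (1 : Fin (1 + 1 + (1 + 1))) 3 0 = 0 by decide,
      show Equiv.swap (1 : Fin (1 + 1 + (1 + 1))) 3 3 = 1 by decide,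
      show Equiv.swap (1 : Fin (1 + 1 + (1 + 1))) 3 2 = 2 by decide]
    ring
  · rw [show Equiv.swap (1 : Fin (1 + 1 + (1 + 1))) 2 1 = 2 by decide,
      show Equiv.swap (1 : Fin (1 + 1 + (1 + 1))) 2 0 = 0 by decide,
      show Equiv.swap (1 : Fin (1 + 1 + (1 + 1))) 2 3 = 3 by decide,
      show Equiv.swap (1 : Fin (1 + 1 + (1 + 1))) 2 2 = 1 by decide]
    ring
  · rw [show Equiv.swap (0 : Fin (1 + 1 + (1 + 1))) 3 1 = 1 by decide,
      show Equiv.swap (0 : Fin (1 + 1 + (1 + 1))) 3 0 = 3 by decide,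
      show Equiv.swap (0 : Fin (1 + 1 + (1 + 1))) 3 3 = 0 by decide,
      show Equiv.swap (0 : Fin (1 + 1 + (1 + 1))) 3 2 = 2 by decide]
    ring
  · rw [show Equiv.swap (0 : Fin (1 + 1 + (1 + 1))) 2 1 = 1 by decide,
      show Equiv.swap (0 : Fin (1 + 1 + (1 + 1))) 2 0 = 2 by decide,
      show Equiv.swap (0 : Fin (1 + 1 + (1 + 1))) 2 3 = 3 by decide,
      show Equiv.swap (0 : Fin (1 + 1 + (1 + 1))) 2 2 = 0 by decide]
    ring

end Algebra

/-! ### Coordinate formulas for `d_N` and the bracket, and their derivatives. -/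

section Flat

variable {E : Type*} [NormedAddCommGroup E] [NormedSpace ℝ E]

/-- The value at `(u, v)` of `d_N a`, for a 1-form `a` on a normed space. -/
def flatDN (N : E → E →L[ℝ] E) (a : E → E →L[ℝ] ℝ) (y u v : E) : ℝ :=
  (fderiv ℝ a y (N y u) v - a y (fderiv ℝ N y u v)) -
    (fderiv ℝ a y (N y v) u - a y (fderiv ℝ N y v u))

/-- The bracket of 1-forms on a normed space defined by the bivector field with sharp map `S`. -/
def flatBracket (S : E → (E →L[ℝ] ℝ) →L[ℝ] E) (b a : E → E →L[ℝ] ℝ) (y : E) : E →L[ℝ] ℝ :=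
  fderiv ℝ a y (S y (b y)) - fderiv ℝ b y (S y (a y)) +
    (a y).comp ((fderiv ℝ S y).flip (b y))

theorem flatBracket_apply (S : E → (E →L[ℝ] ℝ) →L[ℝ] E) (b a : E → E →L[ℝ] ℝ) (y w : E) :
    flatBracket S b a y w = fderiv ℝ a y (S y (b y)) w - fderiv ℝ b y (S y (a y)) w +
      a y (fderiv ℝ S y w (b y)) := rfl

/-- The Lie-derivative part of the compatibility condition of a bivector field with sharp map `S`
and a `(1,1)` tensor field `N` on a normed space, for a constant covector `p` and a constant
vector `u`. -/
def FlatCompatibleAt (S : E → (E →L[ℝ] ℝ) →L[ℝ] E) (N : E → E →L[ℝ] E) (y : E) : Prop :=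
  ∀ (p : E →L[ℝ] ℝ) (u : E),
    fderiv ℝ N y (S y p) u - fderiv ℝ S y (N y u) p + N y (fderiv ℝ S y u p)
      - S y (p.comp (fderiv ℝ N y u)) + S y (p.comp ((fderiv ℝ N y).flip u)) = 0

variable {S : E → (E →L[ℝ] ℝ) →L[ℝ] E} {N : E → E →L[ℝ] E} {a b c : E → E →L[ℝ] ℝ} {x : E}

theorem fderiv_apply_const {F G : Type*} [NormedAddCommGroup F] [NormedSpace ℝ F]
    [NormedAddCommGroup G] [NormedSpace ℝ G] {f : E → F →L[ℝ] G}
    (hf : DifferentiableAt ℝ f x) (w : E) (v : F) :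
    fderiv ℝ (fun y => f y v) x w = fderiv ℝ f x w v := by
  rw [fderiv_clm_apply hf (differentiableAt_const v)]
  simp

theorem fderiv_apply_apply {F G : Type*} [NormedAddCommGroup F] [NormedSpace ℝ F]
    [NormedAddCommGroup G] [NormedSpace ℝ G] {f : E → F →L[ℝ] G} {g : E → F}
    (hf : DifferentiableAt ℝ f x) (hg : DifferentiableAt ℝ g x) (w : E) :
    fderiv ℝ (fun y => f y (g y)) x w = f x (fderiv ℝ g x w) + fderiv ℝ f x w (g x) := by
  rw [fderiv_clm_apply hf hg]
  simp

theorem fderiv_flatBracket (hS : ContDiffAt ℝ ∞ S x) (ha : ContDiffAt ℝ ∞ a x)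
    (hb : ContDiffAt ℝ ∞ b x) (w v : E) :
    fderiv ℝ (flatBracket S b a) x w v =
      fderiv ℝ (fderiv ℝ a) x w (S x (b x)) v + fderiv ℝ a x (fderiv ℝ S x w (b x)) v
      + fderiv ℝ a x (S x (fderiv ℝ b x w)) v
      - (fderiv ℝ (fderiv ℝ b) x w (S x (a x)) v + fderiv ℝ b x (fderiv ℝ S x w (a x)) v
        + fderiv ℝ b x (S x (fderiv ℝ a x w)) v)
      + (fderiv ℝ a x w (fderiv ℝ S x v (b x)) + a x (fderiv ℝ (fderiv ℝ S) x w v (b x))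
        + a x (fderiv ℝ S x v (fderiv ℝ b x w))) := by
  have dS := hS.differentiableAt (by simp)
  have da := ha.differentiableAt (by simp)
  have db := hb.differentiableAt (by simp)
  have dS1 : DifferentiableAt ℝ (fderiv ℝ S) x := (hS.fderiv_right (m := ∞) (by simp)).differentiableAt (by simp)
  have da1 : DifferentiableAt ℝ (fderiv ℝ a) x := (ha.fderiv_right (m := ∞) (by simp)).differentiableAt (by simp)
  have db1 : DifferentiableAt ℝ (fderiv ℝ b) x := (hb.fderiv_right (m := ∞) (by simp)).differentiableAt (by simp)
  have hd : DifferentiableAt ℝ (flatBracket S b a) x := by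
    unfold flatBracket
    have h1 : DifferentiableAt ℝ (fun y => (fderiv ℝ S y).flip (b y)) x :=
      (((ContinuousLinearMap.flipₗᵢ ℝ E (E →L[ℝ] ℝ) E).toContinuousLinearEquiv.differentiableAt).comp x dS1).clm_apply db
    exact ((da1.clm_apply (dS.clm_apply db)).sub (db1.clm_apply (dS.clm_apply da))).add
      (da.clm_comp h1)
  rw [← fderiv_apply_const hd]
  simp only [flatBracket_apply]
  have dSa := dS.clm_apply da
  have dSb := dS.clm_apply db
  have t1 := (da1.clm_apply dSb)
  have t2 := (db1.clm_apply dSa)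
  have dSv : DifferentiableAt ℝ (fun y => fderiv ℝ S y v) x := dS1.clm_apply (differentiableAt_const v)
  have t4 := dSv.clm_apply db
  rw [fderiv_fun_add ((t1.clm_apply (differentiableAt_const v)).fun_sub
      (t2.clm_apply (differentiableAt_const v))) (da.clm_apply t4),
    fderiv_fun_sub (t1.clm_apply (differentiableAt_const v)) (t2.clm_apply (differentiableAt_const v))]
  simp only [_root_.add_apply, _root_.sub_apply]
  rw [fderiv_apply_const t1, fderiv_apply_const t2, fderiv_apply_apply da1 dSb,
    fderiv_apply_apply db1 dSa, fderiv_apply_apply dS da, fderiv_apply_apply dS db,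
    fderiv_apply_apply da t4, fderiv_apply_apply dSv db, fderiv_apply_const dS1]
  simp only [_root_.add_apply, map_add]
  ring

/-- Serves to differentiate the equation `d_N a = a ∧ c`. Along `w = S x (b x)` its second
derivatives of `a` are those occurring in `d_N` of the bracket. -/
theorem fderiv_flatDN (hN : ContDiffAt ℝ ∞ N x) (ha : ContDiffAt ℝ ∞ a x) (w u v : E) :
    fderiv ℝ (fun y => flatDN N a y u v) x w =
      (fderiv ℝ (fderiv ℝ a) x w (N x u) v + fderiv ℝ a x (fderiv ℝ N x w u) v
        - fderiv ℝ a x w (fderiv ℝ N x u v) - a x (fderiv ℝ (fderiv ℝ N) x w u v))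
      - (fderiv ℝ (fderiv ℝ a) x w (N x v) u + fderiv ℝ a x (fderiv ℝ N x w v) u
        - fderiv ℝ a x w (fderiv ℝ N x v u) - a x (fderiv ℝ (fderiv ℝ N) x w v u)) := by
  have dN := hN.differentiableAt (by simp)
  have da := ha.differentiableAt (by simp)
  have dN1 : DifferentiableAt ℝ (fderiv ℝ N) x := (hN.fderiv_right (m := ∞) (by simp)).differentiableAt (by simp)
  have da1 : DifferentiableAt ℝ (fderiv ℝ a) x := (ha.fderiv_right (m := ∞) (by simp)).differentiableAt (by simp)
  have cst : ∀ z : E, DifferentiableAt ℝ (fun _ : E => z) x := fun z => differentiableAt_const z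
  have t1 : ∀ z, DifferentiableAt ℝ (fun y => fderiv ℝ a y (N y z)) x :=
    fun z => da1.clm_apply (dN.clm_apply (cst z))
  have t2 : ∀ z, DifferentiableAt ℝ (fun y => fderiv ℝ N y z) x := fun z => dN1.clm_apply (cst z)
  have t3 : ∀ z z', DifferentiableAt ℝ (fun y => fderiv ℝ N y z z') x :=
    fun z z' => (t2 z).clm_apply (cst z')
  have key : ∀ z z', fderiv ℝ (fun y => fderiv ℝ a y (N y z) z' - a y (fderiv ℝ N y z z')) x w =
      fderiv ℝ (fderiv ℝ a) x w (N x z) z' + fderiv ℝ a x (fderiv ℝ N x w z) z'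
        - fderiv ℝ a x w (fderiv ℝ N x z z') - a x (fderiv ℝ (fderiv ℝ N) x w z z') := by
    intro z z'
    rw [fderiv_fun_sub ((t1 z).clm_apply (cst z')) (da.clm_apply (t3 z z')),
      _root_.sub_apply, fderiv_apply_const (t1 z),
      fderiv_apply_apply da1 (dN.clm_apply (cst z)), fderiv_apply_const dN,
      fderiv_apply_apply da (t3 z z'), fderiv_apply_const (t2 z), fderiv_apply_const dN1]
    simp only [_root_.add_apply]
    ring
  have t5 : ∀ z z', DifferentiableAt ℝ (fun y => fderiv ℝ a y (N y z) z' - a y (fderiv ℝ N y z z')) x :=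
    fun z z' => ((t1 z).clm_apply (cst z')).fun_sub (da.clm_apply (t3 z z'))
  simp only [flatDN]
  rw [fderiv_fun_sub (t5 u v) (t5 v u), _root_.sub_apply, key, key]

theorem fderiv_wedge_apply (ha : DifferentiableAt ℝ a x) (hc : DifferentiableAt ℝ c x)
    (w u v : E) :
    fderiv ℝ (fun y => a y u * c y v - a y v * c y u) x w =
      fderiv ℝ a x w u * c x v + a x u * fderiv ℝ c x w v
      - (fderiv ℝ a x w v * c x u + a x v * fderiv ℝ c x w u) := by
  have t : ∀ {f : E → E →L[ℝ] ℝ} (_ : DifferentiableAt ℝ f x) (z : E),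
    DifferentiableAt ℝ (fun y => f y z) x := fun hf z => hf.clm_apply (differentiableAt_const z)
  rw [fderiv_fun_sub ((t ha u).fun_mul (t hc v)) ((t ha v).fun_mul (t hc u)),
    fderiv_fun_mul (t ha u) (t hc v), fderiv_fun_mul (t ha v) (t hc u)]
  simp only [_root_.add_apply, _root_.sub_apply,
    _root_.smul_apply, smul_eq_mul]
  rw [fderiv_apply_const ha, fderiv_apply_const ha, fderiv_apply_const hc, fderiv_apply_const hc]
  ring

end Flat

/-! ### Differentiated compatibility, and `d_N` of a bracket on a normed space. -/

section Flat

variable {E : Type*} [NormedAddCommGroup E] [NormedSpace ℝ E]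
variable {S : E → (E →L[ℝ] ℝ) →L[ℝ] E} {N : E → E →L[ℝ] E} {a b c : E → E →L[ℝ] ℝ} {x : E}

theorem fderiv_skew (hS : DifferentiableAt ℝ S x)
    (hskew : ∀ᶠ y in 𝓝 x, ∀ p q : E →L[ℝ] ℝ, q (S y p) = - p (S y q)) (w : E)
    (p q : E →L[ℝ] ℝ) : q (fderiv ℝ S x w p) = - p (fderiv ℝ S x w q) := by
  have dS := hS
  have cst : ∀ z : E →L[ℝ] ℝ, DifferentiableAt ℝ (fun _ : E => z) x :=
    fun z => differentiableAt_const z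
  have h : (fun y => q (S y p)) =ᶠ[𝓝 x] fun y => - p (S y q) := by
    filter_upwards [hskew] with y hy using hy p q
  have h2 := congrArg (fun L => L w) (h.fderiv_eq (𝕜 := ℝ))
  rw [fderiv_fun_neg, _root_.neg_apply, fderiv_apply_apply (cst q) (dS.clm_apply (cst p)),
    fderiv_apply_apply (cst p) (dS.clm_apply (cst q)), fderiv_apply_const dS,
    fderiv_apply_const dS] at h2
  simpa using h2

/-- Pairing with `q` and moving `S` to the other side by skewness gives a scalar identity, which is
simpler to differentiate. -/
theorem FlatCompatibleAt.apply {y : E} (h : FlatCompatibleAt S N y)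
    (hskew : ∀ p q : E →L[ℝ] ℝ, q (S y p) = - p (S y q)) (p q : E →L[ℝ] ℝ) (u : E) :
    q (fderiv ℝ N y (S y p) u) - p (fderiv ℝ N y (S y q) u) - q (fderiv ℝ S y (N y u) p)
      + q (N y (fderiv ℝ S y u p)) + p (fderiv ℝ N y u (S y q)) = 0 := by
  have h1 := congrArg q (h p u)
  simp only [map_add, map_sub, map_zero] at h1
  rw [hskew (p.comp (fderiv ℝ N y u)) q, hskew (p.comp ((fderiv ℝ N y).flip u)) q] at h1
  simp only [ContinuousLinearMap.comp_apply, ContinuousLinearMap.flip_apply] at h1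
  linarith

/-- The derivative along `v` of `FlatCompatibleAt.apply`, with `p`, `q`, `u` frozen. It controls the
second derivatives of `S` and `N` in `d_N` of a bracket, which is why compatibility is assumed near
`x` and not only at `x`. -/
theorem fderiv_flatCompatible (hS : ContDiffAt ℝ ∞ S x) (hN : ContDiffAt ℝ ∞ N x)
    (hskew : ∀ᶠ y in 𝓝 x, ∀ p q : E →L[ℝ] ℝ, q (S y p) = - p (S y q))
    (hC : ∀ᶠ y in 𝓝 x, FlatCompatibleAt S N y) (p q : E →L[ℝ] ℝ) (u v : E) :
    q (fderiv ℝ (fderiv ℝ N) x v (S x p) u) + q (fderiv ℝ N x (fderiv ℝ S x v p) u)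
    - p (fderiv ℝ (fderiv ℝ N) x v (S x q) u) - p (fderiv ℝ N x (fderiv ℝ S x v q) u)
    - q (fderiv ℝ (fderiv ℝ S) x v (N x u) p) - q (fderiv ℝ S x (fderiv ℝ N x v u) p)
    + q (fderiv ℝ N x v (fderiv ℝ S x u p)) + q (N x (fderiv ℝ (fderiv ℝ S) x v u p))
    + p (fderiv ℝ (fderiv ℝ N) x v u (S x q)) + p (fderiv ℝ N x u (fderiv ℝ S x v q)) = 0 := by
  have dS := hS.differentiableAt (by simp)
  have dN := hN.differentiableAt (by simp)
  have dS1 : DifferentiableAt ℝ (fderiv ℝ S) x :=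
    (hS.fderiv_right (m := ∞) (by simp)).differentiableAt (by simp)
  have dN1 : DifferentiableAt ℝ (fderiv ℝ N) x :=
    (hN.fderiv_right (m := ∞) (by simp)).differentiableAt (by simp)
  have cst : ∀ z : E, DifferentiableAt ℝ (fun _ : E => z) x := fun z => differentiableAt_const z
  have cst' : ∀ z : E →L[ℝ] ℝ, DifferentiableAt ℝ (fun _ : E => z) x :=
    fun z => differentiableAt_const z
  have h : (fun y => q (fderiv ℝ N y (S y p) u) - p (fderiv ℝ N y (S y q) u)
      - q (fderiv ℝ S y (N y u) p) + q (N y (fderiv ℝ S y u p))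
      + p (fderiv ℝ N y u (S y q))) =ᶠ[𝓝 x] fun _ => (0 : ℝ) := by
    filter_upwards [hskew, hC] with y hy hy' using hy'.apply hy p q u
  have sS : ∀ r, DifferentiableAt ℝ (fun y => S y r) x := fun r => dS.clm_apply (cst' r)
  have t1 : ∀ r, DifferentiableAt ℝ (fun y => fderiv ℝ N y (S y r)) x :=
    fun r => dN1.clm_apply (sS r)
  have t1' : ∀ r, DifferentiableAt ℝ (fun y => fderiv ℝ N y (S y r) u) x :=
    fun r => (t1 r).clm_apply (cst u)
  have sN : DifferentiableAt ℝ (fun y => N y u) x := dN.clm_apply (cst u)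
  have t2 : DifferentiableAt ℝ (fun y => fderiv ℝ S y (N y u)) x := dS1.clm_apply sN
  have t2' : DifferentiableAt ℝ (fun y => fderiv ℝ S y (N y u) p) x := t2.clm_apply (cst' p)
  have t3 : DifferentiableAt ℝ (fun y => fderiv ℝ S y u) x := dS1.clm_apply (cst u)
  have t3' : DifferentiableAt ℝ (fun y => fderiv ℝ S y u p) x := t3.clm_apply (cst' p)
  have t4 : DifferentiableAt ℝ (fun y => N y (fderiv ℝ S y u p)) x := dN.clm_apply t3'
  have t5 : DifferentiableAt ℝ (fun y => fderiv ℝ N y u) x := dN1.clm_apply (cst u)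
  have t5' : DifferentiableAt ℝ (fun y => fderiv ℝ N y u (S y q)) x := t5.clm_apply (sS q)
  have ev : ∀ (r : E →L[ℝ] ℝ) {f : E → E}, DifferentiableAt ℝ f x →
      DifferentiableAt ℝ (fun y => r (f y)) x := fun r _ hf => (cst' r).clm_apply hf
  have ev' : ∀ (r : E →L[ℝ] ℝ) {f : E → E}, DifferentiableAt ℝ f x →
      fderiv ℝ (fun y => r (f y)) x v = r (fderiv ℝ f x v) := fun r f hf => by
    rw [fderiv_apply_apply (cst' r) hf]; simp
  have h2 := congrArg (fun L => L v) (h.fderiv_eq (𝕜 := ℝ))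
  rw [fderiv_fun_add ((((ev q (t1' p)).fun_sub (ev p (t1' q))).fun_sub (ev q t2')).fun_add
      (ev q t4)) (ev p t5'),
    fderiv_fun_add (((ev q (t1' p)).fun_sub (ev p (t1' q))).fun_sub (ev q t2')) (ev q t4),
    fderiv_fun_sub ((ev q (t1' p)).fun_sub (ev p (t1' q))) (ev q t2'),
    fderiv_fun_sub (ev q (t1' p)) (ev p (t1' q))] at h2
  simp only [_root_.add_apply, _root_.sub_apply] at h2
  rw [ev' q (t1' p), ev' p (t1' q), ev' q t2', ev' q t4, ev' p t5',
    fderiv_apply_const (t1 p), fderiv_apply_const (t1 q), fderiv_apply_apply dN1 (sS p),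
    fderiv_apply_apply dN1 (sS q), fderiv_apply_const dS, fderiv_apply_const dS,
    fderiv_apply_const t2, fderiv_apply_apply dS1 sN, fderiv_apply_const dN,
    fderiv_apply_apply dN t3', fderiv_apply_const t3, fderiv_apply_const dS1,
    fderiv_apply_apply t5 (sS q), fderiv_apply_const dS, fderiv_apply_const dN1] at h2
  simp only [_root_.add_apply, map_add, fderiv_fun_const, Pi.zero_apply, _root_.zero_apply] at h2
  linarith

set_option maxHeartbeats 1600000 in
/-- The derivation property of `d_N` with respect to the bracket of 1-forms on a normed space. -/
theorem flatDN_flatBracket (hS : ContDiffAt ℝ ∞ S x) (hN : ContDiffAt ℝ ∞ N x)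
    (ha : ContDiffAt ℝ ∞ a x) (hb : ContDiffAt ℝ ∞ b x) (hc : ContDiffAt ℝ ∞ c x)
    (hskew : ∀ᶠ y in 𝓝 x, ∀ p q : E →L[ℝ] ℝ, q (S y p) = - p (S y q))
    (hcomm : ∀ p : E →L[ℝ] ℝ, S x (p.comp (N x)) = N x (S x p))
    (hC : ∀ᶠ y in 𝓝 x, FlatCompatibleAt S N y)
    (hda : ∀ᶠ y in 𝓝 x, ∀ u v, flatDN N a y u v = a y u * c y v - a y v * c y u)
    (hdb : ∀ᶠ y in 𝓝 x, ∀ u v, flatDN N b y u v = b y u * c y v - b y v * c y u) (u v : E) :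
    flatDN N (flatBracket S b a) x u v =
      2 * (flatBracket S b a x u * c x v - flatBracket S b a x v * c x u)
      + (a x u * flatBracket S b c x v - a x v * flatBracket S b c x u)
      - (b x u * flatBracket S a c x v - b x v * flatBracket S a c x u) := by
  have e1 : ∀ {f : E → E →L[ℝ] ℝ}, ContDiffAt ℝ ∞ f x →
      (∀ᶠ y in 𝓝 x, ∀ u v, flatDN N f y u v = f y u * c y v - f y v * c y u) → ∀ w,
      fderiv ℝ (fun y => flatDN N f y u v) x w =
        fderiv ℝ (fun y => f y u * c y v - f y v * c y u) x w := by
    intro f _ h w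
    rw [Filter.EventuallyEq.fderiv_eq (h.mono fun y hy => hy u v)]
  -- The bracket begins with `Da(S b) - Db(S a)`, so the equation for `a` is differentiated along `S
  -- b` and the one for `b` along `S a`.
  have dda := e1 ha hda (S x (b x))
  have ddb := e1 hb hdb (S x (a x))
  rw [fderiv_flatDN hN ha, fderiv_wedge_apply (ha.differentiableAt (by simp))
    (hc.differentiableAt (by simp))] at dda
  rw [fderiv_flatDN hN hb, fderiv_wedge_apply (hb.differentiableAt (by simp))
    (hc.differentiableAt (by simp))] at ddb
  -- Antisymmetrized in `u` and `v`, these cancel the second derivatives of `S` and `N`.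
  have dC1 := fderiv_flatCompatible hS hN hskew hC (b x) (a x) u v
  have dC2 := fderiv_flatCompatible hS hN hskew hC (b x) (a x) v u
  have sk := hskew.self_of_nhds
  have dsk := fderiv_skew (hS.differentiableAt (by simp)) hskew
  have C0 := hC.self_of_nhds
  replace hda := hda.self_of_nhds
  replace hdb := hdb.self_of_nhds
  have symm : ∀ {F : Type _} [NormedAddCommGroup F] [NormedSpace ℝ F] {f : E → F},
      ContDiffAt ℝ ∞ f x → ∀ w w', fderiv ℝ (fderiv ℝ f) x w w' = fderiv ℝ (fderiv ℝ f) x w' w :=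
    fun hf w w' => (hf.isSymmSndFDerivAt (by simpa using ENat.LEInfty.out)).eq w w'
  -- the defect vector field of the derivation property along `f`
  have key : ∀ f : E → E →L[ℝ] ℝ, (∀ u v, flatDN N f x u v = f x u * c x v - f x v * c x u) →
      ∀ w, fderiv ℝ S x (N x w) (f x) + S x (fderiv ℝ f x (N x w)) =
        fderiv ℝ N x (S x (f x)) w + N x (fderiv ℝ S x w (f x))
        + N x (S x ((fderiv ℝ f x).flip w)) + (f x w) • S x (c x) - (c x w) • S x (f x) := by
    intro f hf w
    -- The equation `d_N f = f ∧ c` solved for the covector `Df(N w)`. Applying `S x` and using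
    -- `hcomm` and compatibility for the covector `f x` yields the claim, whose left side is the
    -- derivative of the vector field `S f` along `N w`.
    have h1 : fderiv ℝ f x (N x w) = ((fderiv ℝ f x).flip w).comp (N x)
        + (f x).comp (fderiv ℝ N x w) - (f x).comp ((fderiv ℝ N x).flip w)
        + (f x w) • c x - (c x w) • f x := by
      ext z
      have := hf w z
      simp only [flatDN] at this
      simp only [_root_.add_apply, _root_.sub_apply, _root_.smul_apply, smul_eq_mul,
        ContinuousLinearMap.comp_apply, ContinuousLinearMap.flip_apply]
      linarith
    have h2 := C0 (f x) w
    rw [h1]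
    simp only [map_add, map_sub, map_smul, hcomm]
    rw [← sub_eq_zero, ← neg_eq_zero, ← h2]
    abel
  have ka := key a hda
  have kb := key b hdb
  have haw := fun w v => hda w v
  have hbw := fun w v => hdb w v
  simp only [flatDN] at haw hbw
  -- `N S = S N^*` is again skew, so the terms quadratic in first derivatives of `a` and `b` match
  -- in pairs.
  have hcross : ∀ w w', fderiv ℝ a x (N x (S x ((fderiv ℝ b x).flip w))) w' =
      - fderiv ℝ b x (N x (S x ((fderiv ℝ a x).flip w'))) w := by
    intro w w'
    have h1 := sk (((fderiv ℝ b x).flip w).comp (N x)) ((fderiv ℝ a x).flip w')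
    rw [hcomm] at h1
    simpa using h1
  have k1 : ∀ w w', fderiv ℝ a x (fderiv ℝ S x (N x w) (b x)) w' +
      fderiv ℝ a x (S x (fderiv ℝ b x (N x w))) w' = _ := fun w w' => by
    have := congrArg (fun z => fderiv ℝ a x z w') (kb w)
    simpa only [map_add, map_sub, map_smul, _root_.add_apply, _root_.sub_apply,
      _root_.smul_apply, smul_eq_mul] using this
  have k2 : ∀ w w', fderiv ℝ b x (fderiv ℝ S x (N x w) (a x)) w' +
      fderiv ℝ b x (S x (fderiv ℝ a x (N x w))) w' = _ := fun w w' => by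
    have := congrArg (fun z => fderiv ℝ b x z w') (ka w)
    simpa only [map_add, map_sub, map_smul, _root_.add_apply, _root_.sub_apply,
      _root_.smul_apply, smul_eq_mul] using this
  -- The hypotheses on vectors `DS_u b`, `DS_u a` take care of the terms in which `N` is applied to
  -- a derivative of `S`.
  have hau := haw (fderiv ℝ S x u (b x)) v
  have hav := haw (fderiv ℝ S x v (b x)) u
  have hbu := hbw (fderiv ℝ S x u (a x)) v
  have hbv := hbw (fderiv ℝ S x v (a x)) u
  have s1 := symm ha (N x u) (S x (b x))
  have s2 := symm ha (N x v) (S x (b x))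
  have s3 := symm hb (N x u) (S x (a x))
  have s4 := symm hb (N x v) (S x (a x))
  have s5 := symm hS (N x u) v
  have s6 := symm hS (N x v) u
  have s7 := symm hN v (S x (b x))
  have s8 := symm hN u (S x (b x))
  have s9 := symm hN v (S x (a x))
  have s10 := symm hN u (S x (a x))
  have s11 := symm hN v u
  have s12 := symm hS v u
  have d1 := dsk v (b x) (a x)
  have d2 := dsk u (b x) (a x)
  have d3 := dsk v (fderiv ℝ b x (N x u)) (a x)
  have d4 := dsk u (fderiv ℝ b x (N x v)) (a x)
  simp only [flatDN, fderiv_flatBracket hS ha hb, flatBracket_apply]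
  rw [s1, s2, s3, s4, s5, s6, d3, d4]
  rw [s7, s9, s11, s12] at dC1
  rw [s8, s10] at dC2
  linear_combination dda - ddb - dC1 + dC2 + k1 u v - k1 v u - k2 u v + k2 v u + hau - hav - hbu + hbv
    + hcross u v - hcross v u - c x v * d2 + c x u * d1

end Flat

/-! ### Coordinate expressions of tensor fields and their smoothness. -/

section Charts

variable {E : Type*} [NormedAddCommGroup E] [NormedSpace ℝ E]
variable {M : Type*} [TopologicalSpace M] [ChartedSpace E M]

/-- The derivative at `y` of the inverse of the chart at `x₀`. -/
def chartInv (x₀ : M) (y : E) : E →L[ℝ] E :=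
  mfderiv 𝓘(ℝ, E) 𝓘(ℝ, E) (extChartAt 𝓘(ℝ, E) x₀).symm y

/-- The derivative of the chart at `x₀`, at the point with coordinates `y`. -/
def chartDer (x₀ : M) (y : E) : E →L[ℝ] E :=
  mfderiv 𝓘(ℝ, E) 𝓘(ℝ, E) (extChartAt 𝓘(ℝ, E) x₀) ((extChartAt 𝓘(ℝ, E) x₀).symm y)

/-- The expression in the chart at `x₀` of a `(1,1)` tensor field. -/
def chartEnd (N : EndField E M) (x₀ : M) (y : E) : E →L[ℝ] E :=
  (chartDer x₀ y).comp (ContinuousLinearMap.comp (N ((extChartAt 𝓘(ℝ, E) x₀).symm y) : E →L[ℝ] E) (chartInv x₀ y))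

/-- The pushforward of a bilinear form on covectors by an endomorphism. -/
def pushBi (B : (E →L[ℝ] ℝ) →L[ℝ] (E →L[ℝ] ℝ) →L[ℝ] ℝ) (D : E →L[ℝ] E) :
    (E →L[ℝ] ℝ) →L[ℝ] (E →L[ℝ] ℝ) →L[ℝ] ℝ :=
  B.bilinearComp ((ContinuousLinearMap.compL ℝ E E ℝ).flip D)
    ((ContinuousLinearMap.compL ℝ E E ℝ).flip D)

/-- The expression in the chart at `x₀` of a contravariant 2-tensor field. -/
def chartBi (P : BiField E M) (x₀ : M) (y : E) : (E →L[ℝ] ℝ) →L[ℝ] (E →L[ℝ] ℝ) →L[ℝ] ℝ :=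
  pushBi (P ((extChartAt 𝓘(ℝ, E) x₀).symm y)) (chartDer x₀ y)

variable [IsManifold 𝓘(ℝ, E) ∞ M]

instance : IsManifold 𝓘(ℝ, E) 1 M := IsManifold.of_le (n := ∞) (by simp)

theorem chartDer_comp_chartInv {x₀ : M} {y : E} (hy : y ∈ (extChartAt 𝓘(ℝ, E) x₀).target) :
    (chartDer x₀ y).comp (chartInv x₀ y) = ContinuousLinearMap.id ℝ E := by
  have := mfderiv_extChartAt_comp_mfderivWithin_extChartAt_symm (I := 𝓘(ℝ, E)) hy
  simp only [modelWithCornersSelf_coe, Set.range_id, mfderivWithin_univ] at this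
  exact this

theorem chartInv_comp_chartDer {x₀ : M} {y : E} (hy : y ∈ (extChartAt 𝓘(ℝ, E) x₀).target) :
    (chartInv x₀ y).comp (chartDer x₀ y) = ContinuousLinearMap.id ℝ E := by
  have := mfderivWithin_extChartAt_symm_comp_mfderiv_extChartAt (I := 𝓘(ℝ, E)) hy
  simp only [modelWithCornersSelf_coe, Set.range_id, mfderivWithin_univ] at this
  exact this

theorem chartDer_chartInv {x₀ : M} {y : E} (hy : y ∈ (extChartAt 𝓘(ℝ, E) x₀).target) (v : E) :
    chartDer x₀ y (chartInv x₀ y v) = v :=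
  congrArg (fun L : E →L[ℝ] E => L v) (chartDer_comp_chartInv hy)

theorem chartInv_chartDer {x₀ : M} {y : E} (hy : y ∈ (extChartAt 𝓘(ℝ, E) x₀).target) (v : E) :
    chartInv x₀ y (chartDer x₀ y v) = v :=
  congrArg (fun L : E →L[ℝ] E => L v) (chartInv_comp_chartDer hy)

/-- Smoothness of `N` and `P` is stated through bundle trivializations. This lemma and the next
identify these with the derivatives of the chart. -/
theorem symmL_eq_chartInv {x₀ : M} {y : E} (hy : y ∈ (extChartAt 𝓘(ℝ, E) x₀).target) :
    (trivializationAt E (TangentSpace 𝓘(ℝ, E)) x₀).symmL ℝ ((extChartAt 𝓘(ℝ, E) x₀).symm y) =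
      chartInv x₀ y := by
  have h := (extChartAt 𝓘(ℝ, E) x₀).map_target hy
  rw [extChartAt_source] at h
  rw [TangentBundle.symmL_trivializationAt h, (extChartAt 𝓘(ℝ, E) x₀).right_inv hy]
  simp only [modelWithCornersSelf_coe, Set.range_id, mfderivWithin_univ]
  rfl

theorem continuousLinearMapAt_eq_chartDer {x₀ : M} {y : E}
    (hy : y ∈ (extChartAt 𝓘(ℝ, E) x₀).target) :
    (trivializationAt E (TangentSpace 𝓘(ℝ, E)) x₀).continuousLinearMapAt ℝ
      ((extChartAt 𝓘(ℝ, E) x₀).symm y) = chartDer x₀ y := by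
  have h := (extChartAt 𝓘(ℝ, E) x₀).map_target hy
  rw [extChartAt_source] at h
  exact TangentBundle.continuousLinearMapAt_trivializationAt h

omit [IsManifold 𝓘(ℝ, E) ∞ M] in
theorem target_mem_nhds (x₀ : M) {y : E} (hy : y ∈ (extChartAt 𝓘(ℝ, E) x₀).target) :
    (extChartAt 𝓘(ℝ, E) x₀).target ∈ 𝓝 y :=
  (isOpen_extChartAt_target (I := 𝓘(ℝ, E)) x₀).mem_nhds hy

theorem contDiffAt_comp_symm {F : Type*} [NormedAddCommGroup F] [NormedSpace ℝ F] {f : M → F}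
    {x₀ : M} (hf : ContMDiffAt 𝓘(ℝ, E) 𝓘(ℝ, F) ∞ f x₀) :
    ContDiffAt ℝ ∞ (fun y => f ((extChartAt 𝓘(ℝ, E) x₀).symm y)) (extChartAt 𝓘(ℝ, E) x₀ x₀) := by
  have h1 : ContMDiffAt 𝓘(ℝ, E) 𝓘(ℝ, E) ∞ (extChartAt 𝓘(ℝ, E) x₀).symm
      (extChartAt 𝓘(ℝ, E) x₀ x₀) :=
    (contMDiffOn_extChartAt_symm x₀).contMDiffAt (target_mem_nhds x₀ (mem_extChartAt_target x₀))
  rw [← contMDiffAt_iff_contDiffAt]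
  refine ContMDiffAt.comp (extChartAt 𝓘(ℝ, E) x₀ x₀) ?_ h1
  rwa [extChartAt_to_inv]

theorem contDiffAt_chartEnd {N : EndField E M} (hN : SmoothEndField N) (x₀ : M) :
    ContDiffAt ℝ ∞ (chartEnd N x₀) (extChartAt 𝓘(ℝ, E) x₀ x₀) := by
  have h := ((contMDiffAt_hom_bundle _).1 (hN x₀)).2
  refine (contDiffAt_comp_symm h).congr_of_eventuallyEq ?_
  filter_upwards [target_mem_nhds x₀ (mem_extChartAt_target x₀)] with y hy
  simp only [ContinuousLinearMap.inCoordinates]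
  rw [symmL_eq_chartInv hy, continuousLinearMapAt_eq_chartDer hy]
  rfl

theorem contDiffAt_chartBi {P : BiField E M} (hP : SmoothBiField P) (x₀ : M) :
    ContDiffAt ℝ ∞ (chartBi P x₀) (extChartAt 𝓘(ℝ, E) x₀ x₀) := by
  have h := ((contMDiffAt_hom_bundle _).1 (hP x₀)).2
  refine (contDiffAt_comp_symm h).congr_of_eventuallyEq ?_
  filter_upwards [target_mem_nhds x₀ (mem_extChartAt_target x₀)] with y hy
  have hs := (extChartAt 𝓘(ℝ, E) x₀).map_target hy
  rw [extChartAt_source] at hs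
  ext p q
  have hb : (extChartAt 𝓘(ℝ, E) x₀).symm y ∈ (trivializationAt (E →L[ℝ] ℝ)
    (fun x : M => TangentSpace 𝓘(ℝ, E) x →L[ℝ] ℝ) x₀).baseSet := ⟨hs, trivial⟩
  -- The inverse trivialization of the cotangent bundle is pullback by the chart.
  have key : ∀ p : E →L[ℝ] ℝ, (trivializationAt (E →L[ℝ] ℝ)
      (fun x : M => TangentSpace 𝓘(ℝ, E) x →L[ℝ] ℝ) x₀).symm
        ((extChartAt 𝓘(ℝ, E) x₀).symm y) p = p.comp (chartDer x₀ y) := by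
    intro p
    refine (Bundle.Pretrivialization.continuousLinearMap_symm_apply' (RingHom.id ℝ)
      (trivializationAt E (TangentSpace 𝓘(ℝ, E)) x₀)
      (trivializationAt ℝ (Bundle.Trivial M ℝ) x₀) hb p).trans ?_
    rw [continuousLinearMapAt_eq_chartDer hy]
    ext v
    simp
    rfl
  refine Eq.trans ?_ (inCoordinates_apply_eq₂ (F₃ := ℝ) (E₃ := Bundle.Trivial M ℝ) hb hb
    trivial).symm
  rw [key, key]
  simp
  rfl

end Charts

/-! ### Smoothness and exterior derivative of forms on a normed space. -/

section FlatForms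

variable {E : Type*} [NormedAddCommGroup E] [NormedSpace ℝ E]

/-- Smoothness of a vector-valued function can be tested on finitely many linear functionals
separating the points. -/
theorem contDiffAt_of_separating {F G : Type*} [NormedAddCommGroup F] [NormedSpace ℝ F]
    [NormedAddCommGroup G] [NormedSpace ℝ G] {ι : Type*} [Finite ι] (l : ι → F →ₗ[ℝ] ℝ)
    (hl : ∀ f, (∀ i, l i f = 0) → f = 0) {n : WithTop ℕ∞} {g : G → F} {x : G}
    (h : ∀ i, ContDiffAt ℝ n (fun y => l i (g y)) x) : ContDiffAt ℝ n g x := by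
  cases nonempty_fintype ι
  -- The functionals embed `F` in `ι → ℝ`, and `R` recovers `g` from its components; `R` is
  -- continuous because its domain is finite-dimensional.
  obtain ⟨R, hR⟩ := (LinearMap.pi l).exists_leftInverse_of_injective
    (LinearMap.ker_eq_bot'.2 fun f hf => hl f fun i => congrFun hf i)
  have h1 : ContDiffAt ℝ n (fun y => LinearMap.toContinuousLinearMap R fun i => l i (g y)) x :=
    (LinearMap.toContinuousLinearMap R).contDiff.contDiffAt.comp x (contDiffAt_pi.2 h)
  refine h1.congr_of_eventuallyEq (Eventually.of_forall fun y => ?_)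
  exact (LinearMap.congr_fun hR (g y)).symm

/-- The values on tuples of basis vectors are finitely many and determine an alternating form. -/
theorem contDiffAt_form [FiniteDimensional ℝ E] {k : ℕ} {n : WithTop ℕ∞}
    {G : Type*} [NormedAddCommGroup G] [NormedSpace ℝ G]
    {w : G → E [⋀^Fin k]→L[ℝ] ℝ} {x : G}
    (h : ∀ m : Fin k → E, ContDiffAt ℝ n (fun y => w y m) x) : ContDiffAt ℝ n w x := by
  let b := Module.finBasis ℝ E
  refine contDiffAt_of_separating
    (fun (s : Fin k → Fin (Module.finrank ℝ E)) =>
      (ContinuousAlternatingMap.apply ℝ E ℝ (fun i => b (s i))).toLinearMap) ?_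
    fun s => h _
  intro f hf
  apply ContinuousAlternatingMap.toAlternatingMap_injective
  refine AlternatingMap.coe_multilinearMap_injective (Module.Basis.ext_multilinear (fun _ => b) fun s => ?_)
  exact hf s

theorem contDiffAt_covector [FiniteDimensional ℝ E] {n : WithTop ℕ∞}
    {G : Type*} [NormedAddCommGroup G] [NormedSpace ℝ G]
    {w : G → E →L[ℝ] ℝ} {x : G}
    (h : ∀ m : E, ContDiffAt ℝ n (fun y => w y m) x) : ContDiffAt ℝ n w x := by
  let b := Module.finBasis ℝ E
  refine contDiffAt_of_separating
    (fun (s : Fin (Module.finrank ℝ E)) =>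
      (ContinuousLinearMap.apply ℝ ℝ (b s)).toLinearMap) ?_ fun s => h _
  intro f hf
  exact ContinuousLinearMap.coe_injective (b.ext fun s => hf s)

theorem ContDiffAt.form_apply {k : ℕ} {n : WithTop ℕ∞}
    {G : Type*} [NormedAddCommGroup G] [NormedSpace ℝ G]
    {w : G → E [⋀^Fin k]→L[ℝ] ℝ} {x : G} (h : ContDiffAt ℝ n w x) (m : Fin k → E) :
    ContDiffAt ℝ n (fun y => w y m) x :=
  (ContinuousAlternatingMap.apply ℝ E ℝ m).contDiff.contDiffAt.comp x h

theorem ContDiffAt.toCov [FiniteDimensional ℝ E] {n : WithTop ℕ∞}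
    {G : Type*} [NormedAddCommGroup G] [NormedSpace ℝ G]
    {w : G → E [⋀^Fin 1]→L[ℝ] ℝ} {x : G} (h : ContDiffAt ℝ n w x) :
    ContDiffAt ℝ n (fun y => toCov (w y)) x := by
  refine contDiffAt_covector fun m => ?_
  simp only [toCov_apply]
  exact ContDiffAt.form_apply h _

variable {x : E}

theorem extDeriv_zero_form {f : E → E [⋀^Fin 0]→L[ℝ] ℝ} (hf : DifferentiableAt ℝ f x)
    (v : Fin (0 + 1) → E) : extDeriv f x v = fderiv ℝ (fun y => f y ![]) x (v 0) := by
  rw [extDeriv_apply hf]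
  simp
  congr 2
  funext y
  exact congrArg (f y) (Subsingleton.elim _ _)

theorem extDeriv_one_form [FiniteDimensional ℝ E] {a : E → E [⋀^Fin 1]→L[ℝ] ℝ}
    (ha : ContDiffAt ℝ 1 a x) (v : Fin (1 + 1) → E) :
    extDeriv a x v = fderiv ℝ (fun y => toCov (a y)) x (v 0) (v 1)
      - fderiv ℝ (fun y => toCov (a y)) x (v 1) (v 0) := by
  rw [extDeriv_apply (ha.differentiableAt (by simp))]
  have hc : DifferentiableAt ℝ (fun y => toCov (a y)) x :=
    (ContDiffAt.toCov ha).differentiableAt (by simp)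
  rw [Fin.sum_univ_two, ← fderiv_apply_const hc, ← fderiv_apply_const hc]
  simp only [apply_eq_toCov]
  simp [Fin.removeNth]
  rfl

theorem contDiffAt_wedge [FiniteDimensional ℝ E] {a b : E → E [⋀^Fin 1]→L[ℝ] ℝ}
    {n : WithTop ℕ∞} (ha : ContDiffAt ℝ n a x) (hb : ContDiffAt ℝ n b x) :
    ContDiffAt ℝ n (fun y => wedgeAlt (a y) (b y)) x := by
  refine contDiffAt_form fun m => ?_
  simp only [wedgeAlt_one_one, toCov_apply]
  exact ((ContDiffAt.form_apply ha _).mul (ContDiffAt.form_apply hb _)).sub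
    ((ContDiffAt.form_apply ha _).mul (ContDiffAt.form_apply hb _))

theorem extDeriv_wedge_one_one [FiniteDimensional ℝ E] {a b : E → E [⋀^Fin 1]→L[ℝ] ℝ}
    (ha : ContDiffAt ℝ 1 a x) (hb : ContDiffAt ℝ 1 b x) (v : Fin (1 + 1 + 1) → E) :
    extDeriv (fun y => wedgeAlt (a y) (b y)) x v =
      wedgeAlt (extDeriv a x) (b x) v - wedgeAlt (a x) (extDeriv b x) v := by
  have hca := (ContDiffAt.toCov ha).differentiableAt (by simp)
  have hcb := (ContDiffAt.toCov hb).differentiableAt (by simp)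
  rw [extDeriv_apply ((contDiffAt_wedge ha hb).differentiableAt (by simp))]
  rw [Fin.sum_univ_three]
  simp only [wedgeAlt_one_one]
  rw [fderiv_wedge_apply hca hcb, fderiv_wedge_apply hca hcb, fderiv_wedge_apply hca hcb]
  rw [wedgeAlt_two_one, wedgeAlt_one_two]
  simp only [extDeriv_one_form ha, extDeriv_one_form hb]
  simp [Fin.removeNth, Fin.succAbove]
  ring

end FlatForms

/-! ### Forms in charts, and chart independence of the exterior derivative. -/

section ChartForms

variable {E : Type*} [NormedAddCommGroup E] [NormedSpace ℝ E]
variable {M : Type*} [TopologicalSpace M] [ChartedSpace E M]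

theorem chartForm_apply {k : ℕ} (θ : Form E M k) (x₀ : M) (y : E) (m : Fin k → E) :
    chartForm θ x₀ y m = (θ ((extChartAt 𝓘(ℝ, E) x₀).symm y) : E [⋀^Fin k]→L[ℝ] ℝ)
      (fun i => chartInv x₀ y (m i)) := rfl

theorem chartForm_add {k : ℕ} (θ η : Form E M k) (x₀ : M) (y : E) :
    chartForm (θ + η) x₀ y = chartForm θ x₀ y + chartForm η x₀ y := rfl

theorem chartForm_sub {k : ℕ} (θ η : Form E M k) (x₀ : M) (y : E) :
    chartForm (θ - η) x₀ y = chartForm θ x₀ y - chartForm η x₀ y := rfl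

theorem chartForm_smul {k : ℕ} (c : ℝ) (θ : Form E M k) (x₀ : M) (y : E) :
    chartForm (c • θ) x₀ y = c • chartForm θ x₀ y := rfl

theorem chartForm_wedge {p q : ℕ} (θ : Form E M p) (η : Form E M q) (x₀ : M) (y : E) :
    chartForm (θ ⋏ η) x₀ y = wedgeAlt (chartForm θ x₀ y) (chartForm η x₀ y) := by
  ext v
  rw [wedgeAlt_apply]
  exact wedgeAlt_apply _ _ _

/-- The covector field expressing a 1-form in the chart at `x₀`. -/
def chartCov (a : Form E M 1) (x₀ : M) (y : E) : E →L[ℝ] ℝ := toCov (chartForm a x₀ y)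

/-- The expression of a vector field in the chart at `x₀`. -/
def chartVec (X : VField E M) (x₀ : M) (y : E) : E :=
  chartDer x₀ y (X ((extChartAt 𝓘(ℝ, E) x₀).symm y))

variable [IsManifold 𝓘(ℝ, E) ∞ M]

theorem chartForm_insertEnd {k : ℕ} (N : EndField E M) (θ : Form E M k) {x₀ : M} {y : E}
    (hy : y ∈ (extChartAt 𝓘(ℝ, E) x₀).target) :
    chartForm (insertEnd N θ) x₀ y = insertEndAlt (chartEnd N x₀ y) (chartForm θ x₀ y) := by
  ext v
  rw [insertEndAlt_apply]
  refine (insertEndAlt_apply _ _ _).trans (Finset.sum_congr rfl fun i _ => ?_)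
  rw [chartForm_apply]
  refine congrArg _ (funext fun j => ?_)
  by_cases h : j = i
  · subst h
    simp only [Function.update_self]
    exact (chartInv_chartDer hy _).symm
  · simp only [Function.update_of_ne h]
    rfl

theorem chartForm_interior {k : ℕ} (X : VField E M) (θ : Form E M (k + 1)) {x₀ : M} {y : E}
    (hy : y ∈ (extChartAt 𝓘(ℝ, E) x₀).target) :
    chartForm (interiorForm X θ) x₀ y = interiorAlt (chartVec X x₀ y) (chartForm θ x₀ y) := by
  ext v
  rw [interiorAlt_apply, chartForm_apply, chartForm_apply]
  refine (interiorAlt_apply _ _ _).trans ?_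
  refine congrArg _ (funext fun j => ?_)
  refine Fin.cases ?_ (fun j => ?_) j
  · exact (chartInv_chartDer hy _).symm
  · rfl

/-- The derivative of a chart is invertible, so a form is determined at `x` by its expression at the
centre of the chart at `x`. -/
theorem form_ext {k : ℕ} {θ η : Form E M k}
    (h : ∀ x₀ : M, ∀ v, chartForm θ x₀ (extChartAt 𝓘(ℝ, E) x₀ x₀) v =
      chartForm η x₀ (extChartAt 𝓘(ℝ, E) x₀ x₀) v) : θ = η := by
  funext x
  have hx := mem_extChartAt_target (I := 𝓘(ℝ, E)) x
  refine ContinuousAlternatingMap.ext fun v => ?_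
  have h1 := h x (fun i => chartDer x (extChartAt 𝓘(ℝ, E) x x) (v i))
  have hv : (fun i => chartInv x (extChartAt 𝓘(ℝ, E) x x)
      (chartDer x (extChartAt 𝓘(ℝ, E) x x) (v i))) = (v : Fin k → E) :=
    funext fun i => chartInv_chartDer hx (v i)
  rw [chartForm_apply, chartForm_apply, hv] at h1
  -- Going to the chart and back gives `x` only propositionally, so the base point is generalized
  -- before substituting.
  have h2 : ∀ (y : M), y = x → (θ y : E [⋀^Fin k]→L[ℝ] ℝ) v = (η y : E [⋀^Fin k]→L[ℝ] ℝ) v →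
    (θ x : E [⋀^Fin k]→L[ℝ] ℝ) v = (η x : E [⋀^Fin k]→L[ℝ] ℝ) v := by
    rintro y rfl hy
    exact hy
  exact h2 _ (extChartAt_to_inv x) h1

/-- A form is smooth at every point, in the chart at that point. -/
def SmoothAtPoints {k : ℕ} (θ : Form E M k) : Prop :=
  ∀ p : M, ContDiffAt ℝ ∞ (chartForm θ p) (extChartAt 𝓘(ℝ, E) p p)

-- Smoothness at chart centres suffices for everything below: `extD` at a point uses the chart at
-- that point, and the smoothness of `N` and `P` is extracted at centres too.
omit [IsManifold 𝓘(ℝ, E) ∞ M] in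
theorem SmoothForm.smoothAtPoints {k : ℕ} {θ : Form E M k} (h : SmoothForm θ) :
    SmoothAtPoints θ := fun p =>
  (h p).contDiffAt (target_mem_nhds p (mem_extChartAt_target p))

/-- The exterior derivative may be computed in any chart. -/
theorem chartForm_extD {k : ℕ} {θ : Form E M k} (hθ : SmoothAtPoints θ) {x₀ : M} {y : E}
    (hy : y ∈ (extChartAt 𝓘(ℝ, E) x₀).target) :
    chartForm (extD θ) x₀ y = extDeriv (chartForm θ x₀) y := by
  set p : M := (extChartAt 𝓘(ℝ, E) x₀).symm y with hp
  set f : E → E := fun z => extChartAt 𝓘(ℝ, E) p ((extChartAt 𝓘(ℝ, E) x₀).symm z) with hf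
  have hsymm : ContMDiffOn 𝓘(ℝ, E) 𝓘(ℝ, E) ∞ (extChartAt 𝓘(ℝ, E) x₀).symm
    (extChartAt 𝓘(ℝ, E) x₀).target := contMDiffOn_extChartAt_symm x₀
  have hU := isOpen_extChartAt_target (I := 𝓘(ℝ, E)) x₀
  have hcont : ContinuousAt (extChartAt 𝓘(ℝ, E) x₀).symm y :=
    (hsymm.contMDiffAt (hU.mem_nhds hy)).continuousAt
  have hev : ∀ᶠ z in 𝓝 y, z ∈ (extChartAt 𝓘(ℝ, E) x₀).target ∧
      (extChartAt 𝓘(ℝ, E) x₀).symm z ∈ (extChartAt 𝓘(ℝ, E) p).source :=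
    Filter.Eventually.and (hU.mem_nhds hy) (hcont ((isOpen_extChartAt_source p).mem_nhds (mem_extChartAt_source p)))
  have hder : ∀ z, z ∈ (extChartAt 𝓘(ℝ, E) x₀).target →
      (extChartAt 𝓘(ℝ, E) x₀).symm z ∈ (extChartAt 𝓘(ℝ, E) p).source →
      ∀ v : E, fderiv ℝ f z v = (mfderiv 𝓘(ℝ, E) 𝓘(ℝ, E) (extChartAt 𝓘(ℝ, E) p)
        ((extChartAt 𝓘(ℝ, E) x₀).symm z) : E →L[ℝ] E) (chartInv x₀ z v) := by
    intro z hz hz' v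
    have h1 : MDifferentiableAt 𝓘(ℝ, E) 𝓘(ℝ, E) (extChartAt 𝓘(ℝ, E) x₀).symm z :=
      (hsymm.contMDiffAt (hU.mem_nhds hz)).mdifferentiableAt (by simp)
    have h2 : MDifferentiableAt 𝓘(ℝ, E) 𝓘(ℝ, E) (extChartAt 𝓘(ℝ, E) p)
        ((extChartAt 𝓘(ℝ, E) x₀).symm z) :=
      mdifferentiableAt_extChartAt (by rwa [extChartAt_source] at hz')
    have h3 := mfderiv_comp z h2 h1
    rw [← mfderiv_eq_fderiv]
    exact congrArg (fun L : E →L[ℝ] E => L v) h3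
  have hfs : ContDiffAt ℝ ∞ f y := by
    rw [← contMDiffAt_iff_contDiffAt]
    exact ContMDiffAt.comp y (contMDiffAt_extChartAt (x := p)) (hsymm.contMDiffAt (hU.mem_nhds hy))
  have hpull : extDeriv (fun z => (chartForm θ p (f z)).compContinuousLinearMap (fderiv ℝ f z)) y =
      (extDeriv (chartForm θ p) (f y)).compContinuousLinearMap (fderiv ℝ f y) :=
    extDeriv_pullback ((hθ p).differentiableAt (by simp)) hfs (by simpa using ENat.LEInfty.out)
  -- `extD` at `p` uses the chart at `p`. Near `y` the expression in the chart at `x₀` is the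
  -- pullback by the transition map `f`, and `f y` is the centre of the chart at `p`; the claim is
  -- then naturality of `extDeriv`.
  have heq : chartForm θ x₀ =ᶠ[𝓝 y]
      fun z => (chartForm θ p (f z)).compContinuousLinearMap (fderiv ℝ f z) := by
    filter_upwards [hev] with z hz
    ext v
    rw [ContinuousAlternatingMap.compContinuousLinearMap_apply, chartForm_apply, chartForm_apply]
    have hq : (extChartAt 𝓘(ℝ, E) p).symm (f z) = (extChartAt 𝓘(ℝ, E) x₀).symm z :=
      (extChartAt 𝓘(ℝ, E) p).left_inv hz.2
    have hfz : f z ∈ (extChartAt 𝓘(ℝ, E) p).target := (extChartAt 𝓘(ℝ, E) p).map_source hz.2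
    have hv : ∀ i, chartInv p (f z) (fderiv ℝ f z (v i)) = chartInv x₀ z (v i) := by
      intro i
      rw [hder z hz.1 hz.2]
      have := chartInv_chartDer hfz (chartInv x₀ z (v i))
      rw [chartDer, hq] at this
      exact this
    simp only [Function.comp_apply, hv]
    exact (congrArg (fun q : M => (θ q : E [⋀^Fin k]→L[ℝ] ℝ) fun i => chartInv x₀ z (v i)) hq).symm
  rw [heq.extDeriv_eq, hpull]
  ext v
  rw [chartForm_apply]
  simp only [extD, ContinuousAlternatingMap.compContinuousLinearMap_apply]
  refine congrArg (extDeriv (chartForm θ p) (f y)) (funext fun i => ?_)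
  exact (hder y hy (mem_extChartAt_source p) (v i)).symm

end ChartForms

/-! ### Insertion and bivector contraction on wedge products. -/

section Algebra

variable {V : Type*} [AddCommGroup V] [Module ℝ V] [TopologicalSpace V]

theorem alt_two_eta (θ : V [⋀^Fin 2]→L[ℝ] ℝ) (w : Fin 2 → V) : θ w = θ ![w 0, w 1] := by
  congr 1; ext i; fin_cases i <;> rfl

theorem toCov_insertEndAlt (A : V →L[ℝ] V) (a : V [⋀^Fin 1]→L[ℝ] ℝ) (v : V) :
    toCov (insertEndAlt A a) v = toCov a (A v) := by
  rw [toCov_apply, insertEndAlt_apply]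
  simp [apply_eq_toCov]

theorem insertEndAlt_two (A : V →L[ℝ] V) (θ : V [⋀^Fin 2]→L[ℝ] ℝ) (v : Fin 2 → V) :
    insertEndAlt A θ v = θ ![A (v 0), v 1] + θ ![v 0, A (v 1)] := by
  rw [insertEndAlt_apply, Fin.sum_univ_two]
  rw [alt_two_eta θ (Function.update v 0 _), alt_two_eta θ (Function.update v 1 _)]
  simp

theorem insertEndAlt_three (A : V →L[ℝ] V) (θ : V [⋀^Fin 3]→L[ℝ] ℝ) (v : Fin 3 → V) :
    insertEndAlt A θ v = θ ![A (v 0), v 1, v 2] + θ ![v 0, A (v 1), v 2]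
      + θ ![v 0, v 1, A (v 2)] := by
  rw [insertEndAlt_apply, Fin.sum_univ_three]
  congr 1
  · congr 1
    · congr 1; ext i; fin_cases i <;> rfl
    · congr 1; ext i; fin_cases i <;> rfl
  · congr 1; ext i; fin_cases i <;> rfl

theorem insertEndAlt_wedge_one_one (A : V →L[ℝ] V) (a b : V [⋀^Fin 1]→L[ℝ] ℝ) :
    insertEndAlt A (wedgeAlt a b) =
      wedgeAlt (insertEndAlt A a) b + wedgeAlt a (insertEndAlt A b) := by
  ext v
  rw [insertEndAlt_two]
  simp only [ContinuousAlternatingMap.add_apply, wedgeAlt_one_one, toCov_insertEndAlt]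
  simp
  ring

theorem insertEndAlt_wedge_two_one (A : V →L[ℝ] V) (θ : V [⋀^Fin 2]→L[ℝ] ℝ)
    (b : V [⋀^Fin 1]→L[ℝ] ℝ) :
    insertEndAlt A (wedgeAlt θ b) =
      wedgeAlt (insertEndAlt A θ) b + wedgeAlt θ (insertEndAlt A b) := by
  ext v
  rw [insertEndAlt_three]
  simp only [ContinuousAlternatingMap.add_apply, wedgeAlt_two_one, toCov_insertEndAlt, insertEndAlt_two]
  simp
  ring

/-- Moving a 1-form past a 2-form takes two sign changes. The degrees `1 + 2` and `2 + 1` both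
reduce to `3`, so no cast is needed. -/
theorem wedgeAlt_two_one_comm (θ : V [⋀^Fin 2]→L[ℝ] ℝ) (b : V [⋀^Fin 1]→L[ℝ] ℝ) :
    wedgeAlt b θ = wedgeAlt θ b := by
  ext v
  refine (wedgeAlt_one_two b θ v).trans (Eq.trans ?_ (wedgeAlt_two_one θ b v).symm)
  ring

theorem insertEndAlt_wedge_one_two (A : V →L[ℝ] V) (b : V [⋀^Fin 1]→L[ℝ] ℝ)
    (θ : V [⋀^Fin 2]→L[ℝ] ℝ) :
    insertEndAlt A (wedgeAlt b θ) =
      wedgeAlt (insertEndAlt A b) θ + wedgeAlt b (insertEndAlt A θ) := by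
  rw [wedgeAlt_two_one_comm, wedgeAlt_two_one_comm, wedgeAlt_two_one_comm]
  exact (insertEndAlt_wedge_two_one A θ b).trans (add_comm _ _)

theorem toCov_interiorAlt (w v : V) (θ : V [⋀^Fin 2]→L[ℝ] ℝ) :
    toCov (interiorAlt w θ) v = θ ![w, v] := by
  rw [toCov_apply, interiorAlt_apply]

variable [FiniteDimensional ℝ V] [IsTopologicalAddGroup V] [ContinuousSMul ℝ V] [T2Space V]

theorem contractAlt_apply {k : ℕ} (P : (V →L[ℝ] ℝ) →L[ℝ] (V →L[ℝ] ℝ) →L[ℝ] ℝ)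
    (θ : V [⋀^Fin (k + 2)]→L[ℝ] ℝ) (m : Fin k → V) :
    contractAlt P θ m = (1 / 2) * ∑ i, θ (Matrix.vecCons (Module.finBasis ℝ V i)
      (Matrix.vecCons (sharpVec P (LinearMap.toContinuousLinearMap
        ((Module.finBasis ℝ V).coord i))) m)) := by
  simp only [contractAlt, ContinuousAlternatingMap.smul_apply, smul_eq_mul]
  rw [ContinuousAlternatingMap.sum_apply]
  rfl

/-- Expanding `b` in the dual basis evaluates the basis sum that defines `contractAlt`. -/
theorem sum_apply_sharpVec (P : (V →L[ℝ] ℝ) →L[ℝ] (V →L[ℝ] ℝ) →L[ℝ] ℝ) (b f : V →L[ℝ] ℝ) :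
    ∑ i, b (Module.finBasis ℝ V i) * f (sharpVec P (LinearMap.toContinuousLinearMap
      ((Module.finBasis ℝ V).coord i))) = P b f := by
  have hb : b = ∑ i, b (Module.finBasis ℝ V i) • LinearMap.toContinuousLinearMap
      ((Module.finBasis ℝ V).coord i) := by
    apply ContinuousLinearMap.coe_injective
    refine (Module.finBasis ℝ V).ext fun j => ?_
    simp [Finsupp.single_apply]
  conv_rhs => rw [hb]
  simp only [apply_sharpVec, map_sum, map_smul, _root_.sum_apply, _root_.smul_apply, smul_eq_mul]

variable {P : (V →L[ℝ] ℝ) →L[ℝ] (V →L[ℝ] ℝ) →L[ℝ] ℝ} (hP : ∀ a b, P a b = - P b a)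
include hP

/-- The two terms of `a ∧ b` contribute equally because `P` is skew, which absorbs the factor `1 /
2`. -/
theorem contractAlt_wedge_one_one (a b : V [⋀^Fin 1]→L[ℝ] ℝ) :
    contractAlt (k := 0) P (wedgeAlt (p := 1) (q := 1) a b) = interiorAlt (sharpVec P (toCov a)) b := by
  ext m
  rw [contractAlt_apply, interiorAlt_apply, apply_eq_toCov b]
  refine Eq.trans ?_ (apply_sharpVec P (toCov a) (toCov b)).symm
  have h1 := sum_apply_sharpVec P (toCov a) (toCov b)
  have h2 := sum_apply_sharpVec P (toCov b) (toCov a)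
  have h3 : ∀ i, wedgeAlt a b (Matrix.vecCons (Module.finBasis ℝ V i)
      (Matrix.vecCons (sharpVec P (LinearMap.toContinuousLinearMap
        ((Module.finBasis ℝ V).coord i))) m)) =
      toCov a (Module.finBasis ℝ V i) * toCov b (sharpVec P (LinearMap.toContinuousLinearMap
        ((Module.finBasis ℝ V).coord i)))
      - toCov b (Module.finBasis ℝ V i) * toCov a (sharpVec P (LinearMap.toContinuousLinearMap
        ((Module.finBasis ℝ V).coord i))) := by
    intro i
    refine (wedgeAlt_one_one a b _).trans ?_
    simp only [Matrix.cons_val_zero, Matrix.cons_val_one]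
    ring
  simp only [h3]
  rw [Finset.sum_sub_distrib, h1, h2, hP (toCov b) (toCov a)]
  ring

/-- If both contracted slots fall in `θ`, one gets `i_P θ`. The two cyclic terms with one slot in
`b` agree by skewness of `P` and together give the interior product. -/
theorem contractAlt_wedge_two_one (θ : V [⋀^Fin 2]→L[ℝ] ℝ) (b : V [⋀^Fin 1]→L[ℝ] ℝ) :
    contractAlt (k := 1) P (wedgeAlt (p := 2) (q := 1) θ b) =
      wedgeAlt (p := 0) (q := 1) (contractAlt (k := 0) P θ) b + interiorAlt (k := 1) (sharpVec P (toCov b)) θ := by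
  ext m
  rw [contractAlt_apply]
  refine Eq.trans ?_ (ContinuousAlternatingMap.add_apply _ _ m).symm
  rw [interiorAlt_apply]
  rw [show wedgeAlt (p := 0) (q := 1) (contractAlt (k := 0) P θ) b m = _ from
    wedgeAlt_zero_one (contractAlt (k := 0) P θ) b m, contractAlt_apply]
  have h1 := sum_apply_sharpVec P (toCov b) (toCov (interiorAlt (m 0) θ))
  have h2 := sum_apply_sharpVec P (toCov (interiorAlt (m 0) θ)) (toCov b)
  have h3 : ∀ i, wedgeAlt θ b (Matrix.vecCons (Module.finBasis ℝ V i)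
      (Matrix.vecCons (sharpVec P (LinearMap.toContinuousLinearMap
        ((Module.finBasis ℝ V).coord i))) m)) =
      θ ![Module.finBasis ℝ V i, sharpVec P (LinearMap.toContinuousLinearMap
        ((Module.finBasis ℝ V).coord i))] * toCov b (m 0)
      - toCov b (Module.finBasis ℝ V i) * toCov (interiorAlt (m 0) θ)
          (sharpVec P (LinearMap.toContinuousLinearMap ((Module.finBasis ℝ V).coord i)))
      + toCov (interiorAlt (m 0) θ) (Module.finBasis ℝ V i) *
          toCov b (sharpVec P (LinearMap.toContinuousLinearMap
            ((Module.finBasis ℝ V).coord i))) := by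
    intro i
    refine (wedgeAlt_two_one θ b _).trans ?_
    rw [toCov_interiorAlt, toCov_interiorAlt, alt_two_swap θ (m 0) (sharpVec P _)]
    simp only [Matrix.cons_val_zero, Matrix.cons_val_one, Matrix.cons_val]
    ring
  simp only [h3]
  rw [Finset.sum_add_distrib, Finset.sum_sub_distrib, h1, h2, ← Finset.sum_mul,
    hP (toCov (interiorAlt (m 0) θ)) (toCov b), ← apply_sharpVec P (toCov b), toCov_interiorAlt,
    alt_two_swap, alt_two_eta θ (Matrix.vecCons _ m)]
  simp only [Matrix.cons_val_zero, Matrix.cons_val_one]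
  ring

end Algebra

/-! ### Derivation property of `d_N`, and the Koszul differential. -/

section GlobalForms

variable {E : Type*} [NormedAddCommGroup E] [NormedSpace ℝ E]
variable {M : Type*} [TopologicalSpace M] [ChartedSpace E M]

theorem insertEnd_wedge_one_one (N : EndField E M) (a b : Form E M 1) :
    insertEnd N (a ⋏ b) = insertEnd N a ⋏ b + a ⋏ insertEnd N b :=
  funext fun x => insertEndAlt_wedge_one_one (N x) (a x) (b x)

theorem insertEnd_wedge_two_one (N : EndField E M) (a : Form E M 2) (b : Form E M 1) :
    insertEnd N (a ⋏ b) = insertEnd N a ⋏ b + a ⋏ insertEnd N b :=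
  funext fun x => insertEndAlt_wedge_two_one (N x) (a x) (b x)

theorem insertEnd_wedge_one_two (N : EndField E M) (a : Form E M 1) (b : Form E M 2) :
    insertEnd N (a ⋏ b) = insertEnd N a ⋏ b + a ⋏ insertEnd N b :=
  funext fun x => insertEndAlt_wedge_one_two (N x) (a x) (b x)

theorem insertEnd_sub {k : ℕ} (N : EndField E M) (a b : Form E M k) :
    insertEnd N (a - b) = insertEnd N a - insertEnd N b := by
  funext x
  ext v
  refine (insertEndAlt_apply _ _ _).trans ?_
  refine Eq.trans ?_ (congrArg₂ (· - ·) (insertEndAlt_apply (N x) (a x) v).symm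
    (insertEndAlt_apply (N x) (b x) v).symm)
  rw [← Finset.sum_sub_distrib]
  rfl

variable [IsManifold 𝓘(ℝ, E) ∞ M]

omit [IsManifold 𝓘(ℝ, E) ∞ M] in
theorem SmoothAtPoints.add {k : ℕ} {a b : Form E M k} (ha : SmoothAtPoints a)
    (hb : SmoothAtPoints b) : SmoothAtPoints (a + b) := fun p => (ha p).add (hb p)

omit [IsManifold 𝓘(ℝ, E) ∞ M] in
theorem SmoothAtPoints.smul {k : ℕ} {a : Form E M k} (c : ℝ) (ha : SmoothAtPoints a) :
    SmoothAtPoints (c • a) := fun p => (contDiffAt_const (c := c)).smul (ha p)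

omit [IsManifold 𝓘(ℝ, E) ∞ M] in
theorem SmoothAtPoints.wedge [FiniteDimensional ℝ E] {a b : Form E M 1} (ha : SmoothAtPoints a)
    (hb : SmoothAtPoints b) : SmoothAtPoints (a ⋏ b) := fun p => by
  refine (contDiffAt_wedge (ha p) (hb p)).congr_of_eventuallyEq (Eventually.of_forall fun y => ?_)
  exact chartForm_wedge a b p y

theorem SmoothAtPoints.insertEnd [FiniteDimensional ℝ E] {a : Form E M 1} (ha : SmoothAtPoints a)
    {N : EndField E M} (hN : SmoothEndField N) : SmoothAtPoints (insertEnd N a) := fun p => by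
  have h : ContDiffAt ℝ ∞ (fun y => insertEndAlt (chartEnd N p y) (chartForm a p y))
      (extChartAt 𝓘(ℝ, E) p p) := by
    refine contDiffAt_form fun m => ?_
    simp only [apply_eq_toCov, toCov_insertEndAlt]
    exact (ContDiffAt.toCov (ha p)).clm_apply
      ((contDiffAt_chartEnd hN p).clm_apply contDiffAt_const)
  refine h.congr_of_eventuallyEq ?_
  filter_upwards [target_mem_nhds p (mem_extChartAt_target p)] with y hy
  exact chartForm_insertEnd N a hy

theorem extD_add {k : ℕ} {a b : Form E M k} (ha : SmoothAtPoints a) (hb : SmoothAtPoints b) :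
    extD (a + b) = extD a + extD b := by
  refine form_ext fun x v => ?_
  have hx := mem_extChartAt_target (I := 𝓘(ℝ, E)) x
  rw [chartForm_add, chartForm_extD (ha.add hb) hx, chartForm_extD ha hx, chartForm_extD hb hx]
  exact congrArg (fun w => w v) (extDeriv_add ((ha x).differentiableAt (by simp))
    ((hb x).differentiableAt (by simp)))

theorem extD_smul {k : ℕ} {a : Form E M k} (c : ℝ) (ha : SmoothAtPoints a) :
    extD (c • a) = c • extD a := by
  refine form_ext fun x v => ?_
  have hx := mem_extChartAt_target (I := 𝓘(ℝ, E)) x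
  rw [chartForm_smul, chartForm_extD (ha.smul c) hx, chartForm_extD ha hx]
  exact congrArg (fun w => w v) (extDeriv_smul c (chartForm a x))

variable [FiniteDimensional ℝ E]

theorem extD_wedge_one_one {a b : Form E M 1} (ha : SmoothAtPoints a) (hb : SmoothAtPoints b) :
    extD (a ⋏ b) = extD a ⋏ b - a ⋏ extD b := by
  refine form_ext fun x v => ?_
  have hx := mem_extChartAt_target (I := 𝓘(ℝ, E)) x
  have h : chartForm (a ⋏ b) x = fun y => wedgeAlt (chartForm a x y) (chartForm b x y) :=
    funext fun y => chartForm_wedge a b x y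
  rw [chartForm_extD (ha.wedge hb) hx, h,
    extDeriv_wedge_one_one ((ha x).of_le (by simp)) ((hb x).of_le (by simp))]
  rw [← chartForm_extD ha hx, ← chartForm_extD hb hx]
  rfl

/-- `d_N` is a derivation of degree one of the wedge product of 1-forms. -/
theorem dN_wedge_one_one {N : EndField E M} (hN : SmoothEndField N) {a b : Form E M 1}
    (ha : SmoothAtPoints a) (hb : SmoothAtPoints b) :
    dN N (a ⋏ b) = dN N a ⋏ b - a ⋏ dN N b := by
  have ha' := ha.insertEnd hN
  have hb' := hb.insertEnd hN
  have h1 : insertEnd N (extD (a ⋏ b)) =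
      (insertEnd N (extD a) ⋏ b + extD a ⋏ insertEnd N b)
        - (insertEnd N a ⋏ extD b + a ⋏ insertEnd N (extD b)) := by
    rw [extD_wedge_one_one ha hb]
    refine (insertEnd_sub (k := 1 + 1 + 1) N (wedge (p := 1 + 1) (q := 1) (extD a) b)
      (wedge (p := 1) (q := 1 + 1) a (extD b))).trans ?_
    exact congrArg₂ (fun s t : Form E M (1 + 1 + 1) => s - t) (insertEnd_wedge_two_one N (extD a) b)
      (insertEnd_wedge_one_two N a (extD b))
  have h2 : extD (insertEnd N (a ⋏ b)) =
      (extD (insertEnd N a) ⋏ b - insertEnd N a ⋏ extD b)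
        + (extD a ⋏ insertEnd N b - a ⋏ extD (insertEnd N b)) := by
    rw [insertEnd_wedge_one_one, extD_add (ha'.wedge hb) (ha.wedge hb'),
      extD_wedge_one_one ha' hb, extD_wedge_one_one ha hb']
  have h3 : dN N a ⋏ b = insertEnd N (extD a) ⋏ b - extD (insertEnd N a) ⋏ b := by
    funext x
    ext v
    refine (wedgeAlt_two_one _ _ v).trans ?_
    refine Eq.trans ?_ (congrArg₂ (· - ·)
      (wedgeAlt_two_one (insertEnd N (extD a) x) (b x) v).symm
      (wedgeAlt_two_one (extD (insertEnd N a) x) (b x) v).symm)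
    simp only [dN, Pi.sub_apply, ContinuousAlternatingMap.sub_apply]
    ring
  have h4 : a ⋏ dN N b = a ⋏ insertEnd N (extD b) - a ⋏ extD (insertEnd N b) := by
    funext x
    ext v
    refine (wedgeAlt_one_two _ _ v).trans ?_
    refine Eq.trans ?_ (congrArg₂ (· - ·)
      (wedgeAlt_one_two (a x) (insertEnd N (extD b) x) v).symm
      (wedgeAlt_one_two (a x) (extD (insertEnd N b) x) v).symm)
    simp only [dN, Pi.sub_apply, ContinuousAlternatingMap.sub_apply]
    ring
  -- The mixed terms `da ∧ i_N b` and `i_N a ∧ db` cancel in the commutator.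
  rw [h3, h4, dN, h1, h2]
  have h5 : ∀ {G : Type _} [AddCommGroup G] (A B C D A' D' : G),
    A + B - (C + D) - (A' - C + (B - D')) = A - A' - (D - D') := by intros; abel
  exact h5 (G := Form E M (1 + 1 + 1)) _ _ _ _ _ _

variable {P : BiField E M} (hP : ∀ x a b, P x a b = - P x b a)
include hP

omit [IsManifold 𝓘(ℝ, E) ∞ M] in
theorem contract_wedge_one_one (a b : Form E M 1) :
    contract (k := 0) P (wedge (p := 1) (q := 1) a b) = interiorForm (sharp P a) b := by
  funext x
  have : FiniteDimensional ℝ (TangentSpace 𝓘(ℝ, E) x) := inferInstanceAs (FiniteDimensional ℝ E)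
  have : T2Space (TangentSpace 𝓘(ℝ, E) x) := inferInstanceAs (T2Space E)
  exact contractAlt_wedge_one_one (hP x) (a x) (b x)

omit [IsManifold 𝓘(ℝ, E) ∞ M] in
theorem contract_wedge_two_one (a : Form E M 2) (b : Form E M 1) :
    contract (k := 1) P (wedge (p := 2) (q := 1) a b) =
      contract (k := 0) P a ⋏ b + interiorForm (k := 1) (sharp P b) a := by
  funext x
  have : FiniteDimensional ℝ (TangentSpace 𝓘(ℝ, E) x) := inferInstanceAs (FiniteDimensional ℝ E)
  have : T2Space (TangentSpace 𝓘(ℝ, E) x) := inferInstanceAs (T2Space E)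
  exact contractAlt_wedge_two_one (hP x) (a x) (b x)

omit [IsManifold 𝓘(ℝ, E) ∞ M] hP in
theorem contract_sub {k : ℕ} (a b : Form E M (k + 2)) :
    contract P (a - b) = contract P a - contract P b := by
  funext x
  have : FiniteDimensional ℝ (TangentSpace 𝓘(ℝ, E) x) := inferInstanceAs (FiniteDimensional ℝ E)
  have : T2Space (TangentSpace 𝓘(ℝ, E) x) := inferInstanceAs (T2Space E)
  ext v
  refine (contractAlt_apply (P x) ((a - b) x) v).trans ?_
  refine Eq.trans ?_ (congrArg₂ (· - ·) (contractAlt_apply (P x) (a x) v).symm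
    (contractAlt_apply (P x) (b x) v).symm)
  rw [← mul_sub, ← Finset.sum_sub_distrib]
  rfl

/-- By the Leibniz rule and the contraction formulas, the terms without a factor `i_P da` or `i_P
db` are `i_{P♯b} da - i_{P♯a} db - d⟨b, P♯a⟩`. This is the bracket of `b` and `a` once Cartan's
formula is inserted in its definition. -/
theorem koszulDiff_wedge_one_one {a b : Form E M 1} (ha : SmoothAtPoints a)
    (hb : SmoothAtPoints b) :
    koszulDiff P (k := 1) (a ⋏ b) = koszul₁ P b a + contract (k := 0) P (extD a) ⋏ b
      - contract (k := 0) P (extD b) ⋏ a := by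
  have h1 : contract (k := 1) P (extD (wedge (p := 1) (q := 1) a b)) =
      contract (k := 0) P (extD a) ⋏ b + interiorForm (k := 1) (sharp P b) (extD a)
        - (contract (k := 0) P (extD b) ⋏ a + interiorForm (k := 1) (sharp P a) (extD b)) := by
    rw [extD_wedge_one_one ha hb]
    refine (contract_sub (k := 1) (wedge (p := 1 + 1) (q := 1) (extD a) b)
      (wedge (p := 1) (q := 1 + 1) a (extD b))).trans ?_
    refine congrArg₂ (fun s t : Form E M 1 => s - t) (contract_wedge_two_one hP (extD a) b) ?_
    refine Eq.trans ?_ (contract_wedge_two_one hP (extD b) a)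
    exact congrArg (contract (k := 1) P) (funext fun x => wedgeAlt_two_one_comm _ _)
  change contract (k := 1) P (extD (wedge (p := 1) (q := 1) a b)) - extD (contract (k := 0) P (wedge (p := 1) (q := 1) a b)) = _
  rw [h1, contract_wedge_one_one hP a b]
  simp only [koszul₁, lieForm]
  have h5 : ∀ {G : Type _} [AddCommGroup G] (A B C D I J : G),
    A + B - (C + D) - I = B + J - (D + I) - J + A - C := by intros; abel
  exact h5 (G := Form E M 1) _ _ _ _ _ _

omit [IsManifold 𝓘(ℝ, E) ∞ M] hP in
theorem koszulDiff_zero {k : ℕ} : koszulDiff P (k := k + 1) (0 : Form E M (k + 1 + 1)) = 0 := by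
  have hc : ∀ {k : ℕ}, contract P (0 : Form E M (k + 2)) = 0 := by
    intro k
    have := contract_sub (P := P) (0 : Form E M (k + 2)) 0
    simpa using this
  have hd : ∀ {k : ℕ}, extD (0 : Form E M k) = 0 := by
    intro k
    funext x
    have h0 : extDeriv (chartForm (0 : Form E M k) x) (extChartAt 𝓘(ℝ, E) x x) = 0 := by
      rw [show chartForm (0 : Form E M k) x = (0 : ℝ) • chartForm (0 : Form E M k) x from
        (zero_smul ℝ _).symm, extDeriv_smul, zero_smul]
    simp only [extD, h0]
    rfl
  change contract P (extD (0 : Form E M (k + 1 + 1))) - extD (contract P 0) = 0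
  rw [hd, hc, hc, hd, sub_zero]

/-- The Koszul bracket of a decomposable 2-form with itself. -/
theorem koszul_self_of_decomposable {a b : Form E M 1} (ha : SmoothAtPoints a)
    (hb : SmoothAtPoints b) :
    (1 / 2 : ℝ) • koszul P (p := 1) (q := 1) (a ⋏ b) (a ⋏ b) = a ⋏ (koszul₁ P b a ⋏ b) := by
  -- With the leading term gone, Koszul's formula is `-∂Ω ∧ Ω - Ω ∧ ∂Ω` for `Ω = a ∧ b`, and the two
  -- terms agree.
  have hsq : wedge (p := 1 + 1) (q := 1 + 1) (a ⋏ b) (a ⋏ b) = 0 :=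
    funext fun x => wedgeAlt_self_of_decomposable (a x) (b x)
  have hz : koszulDiff P (k := 1 + 1 + 1) (wedge (p := 1 + 1) (q := 1 + 1) (a ⋏ b) (a ⋏ b)) = 0 := by
    rw [hsq]
    exact koszulDiff_zero (k := 1 + 1)
  have hcast : castForm (m := 1 + (1 + 1)) (n := 1 + 1 + 1) (by omega)
      (koszulDiff P (k := 1) (a ⋏ b) ⋏ (a ⋏ b)) = koszulDiff P (k := 1) (a ⋏ b) ⋏ (a ⋏ b) := rfl
  unfold koszul
  rw [hz, hcast, koszulDiff_wedge_one_one hP ha hb]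
  funext x
  ext v
  set K := koszul₁ P b a
  set f := contract (k := 0) P (extD a)
  set g := contract (k := 0) P (extD b)
  have e1 := wedgeAlt_one_two ((K + f ⋏ b - g ⋏ a) x) (wedgeAlt (a x) (b x)) v
  have e2 := wedgeAlt_two_one (wedgeAlt (a x) (b x)) ((K + f ⋏ b - g ⋏ a) x) v
  have e3 := wedgeAlt_one_two (a x) (wedgeAlt (K x) (b x)) v
  -- The multiples of `a` and `b` in `∂(a ∧ b)` vanish against `a ∧ b`; only `K` survives the final
  -- `ring`.
  have e4 : ∀ u, toCov ((K + f ⋏ b - g ⋏ a) x) u =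
      toCov (K x) u + f x ![] * toCov (b x) u - g x ![] * toCov (a x) u := by
    intro u
    rw [toCov_apply, toCov_apply]
    refine (congrArg₂ (fun s t => K x ![u] + s - t) (wedgeAlt_zero_one (f x) (b x) ![u])
      (wedgeAlt_zero_one (g x) (a x) ![u])).trans ?_
    rfl
  refine Eq.trans ?_ e3.symm
  change (1 / 2 : ℝ) * ((-1) ^ (1 + 1) * (0 - wedgeAlt ((K + f ⋏ b - g ⋏ a) x) (wedgeAlt (a x) (b x)) v
    - (-1) ^ (1 + 1) * wedgeAlt (wedgeAlt (a x) (b x)) ((K + f ⋏ b - g ⋏ a) x) v)) = _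
  rw [e1, e2]
  simp only [e4, wedgeAlt_one_one]
  simp only [Matrix.cons_val_zero, Matrix.cons_val_one]
  ring

end GlobalForms

/-! ### The sharp map, Lie derivatives and the bracket of 1-forms in charts. -/

section Sharp

variable {E : Type*} [NormedAddCommGroup E] [NormedSpace ℝ E] [FiniteDimensional ℝ E]

variable (E) in
/-- The inverse of the canonical map of a finite-dimensional space to its bidual. -/
def bidualInv : ((E →L[ℝ] ℝ) →L[ℝ] ℝ) →L[ℝ] E :=
  LinearMap.toContinuousLinearMap
    { toFun := fun Φ => (Module.evalEquiv ℝ E).symm (Φ.toLinearMap ∘ₗ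
        (LinearMap.toContinuousLinearMap (𝕜 := ℝ) (E := E) (F' := ℝ)).toLinearMap)
      map_add' := fun Φ Ψ => by
        rw [← map_add]
        rfl
      map_smul' := fun c Φ => by
        rw [← map_smul]
        rfl }

theorem apply_bidualInv (Φ : (E →L[ℝ] ℝ) →L[ℝ] ℝ) (q : E →L[ℝ] ℝ) :
    q (bidualInv E Φ) = Φ q :=
  Module.apply_evalEquiv_symm_apply (R := ℝ) (M := E) q.toLinearMap
    (Φ.toLinearMap ∘ₗ
      (LinearMap.toContinuousLinearMap (𝕜 := ℝ) (E := E) (F' := ℝ)).toLinearMap)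

theorem eq_of_forall_covector {v w : E} (h : ∀ q : E →L[ℝ] ℝ, q v = q w) : v = w :=
  (Module.evalEquiv ℝ E).injective (LinearMap.ext fun q =>
    h (LinearMap.toContinuousLinearMap q))

variable {M : Type*} [TopologicalSpace M] [ChartedSpace E M]

/-- The sharp map of a contravariant 2-tensor field, in the chart at `x₀`. -/
def chartSharp (P : BiField E M) (x₀ : M) (y : E) : (E →L[ℝ] ℝ) →L[ℝ] E :=
  (bidualInv E).comp (chartBi P x₀ y)

theorem apply_chartSharp (P : BiField E M) (x₀ : M) (y : E) (p q : E →L[ℝ] ℝ) :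
    q (chartSharp P x₀ y p) = chartBi P x₀ y p q := apply_bidualInv _ _

/-- The pullback by the chart at `x₀` of a covector at the point with coordinates `y`. -/
def pullCov (x₀ : M) (y : E) (p : E →L[ℝ] ℝ) :
    TangentSpace 𝓘(ℝ, E) ((extChartAt 𝓘(ℝ, E) x₀).symm y) →L[ℝ] ℝ :=
  (p.comp (chartDer x₀ y) : E →L[ℝ] ℝ)

omit [FiniteDimensional ℝ E] in
theorem chartBi_apply (P : BiField E M) (x₀ : M) (y : E) (p q : E →L[ℝ] ℝ) :
    chartBi P x₀ y p q =
      P ((extChartAt 𝓘(ℝ, E) x₀).symm y) (pullCov x₀ y p) (pullCov x₀ y q) := rfl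

theorem chartSharp_skew {P : BiField E M} (hP : ∀ x a b, P x a b = -P x b a) (x₀ : M) (y : E)
    (p q : E →L[ℝ] ℝ) : q (chartSharp P x₀ y p) = - p (chartSharp P x₀ y q) := by
  rw [apply_chartSharp, apply_chartSharp, chartBi_apply, chartBi_apply]
  exact hP _ _ _

theorem apply_sharp (P : BiField E M) (a : Form E M 1) (x : M)
    (b : TangentSpace 𝓘(ℝ, E) x →L[ℝ] ℝ) : b (sharp P a x) = P x (covector a x) b :=
  haveI : FiniteDimensional ℝ (TangentSpace 𝓘(ℝ, E) x) := inferInstanceAs (FiniteDimensional ℝ E)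
  haveI : T2Space (TangentSpace 𝓘(ℝ, E) x) := inferInstanceAs (T2Space E)
  apply_sharpVec (P x) (covector a x) b

variable [IsManifold 𝓘(ℝ, E) ∞ M]

/-- `bidualInv E` is one fixed continuous linear map, so smoothness passes from `chartBi` to the
sharp map. -/
theorem contDiffAt_chartSharp {P : BiField E M} (hP : SmoothBiField P) (x₀ : M) :
    ContDiffAt ℝ ∞ (chartSharp P x₀) (extChartAt 𝓘(ℝ, E) x₀ x₀) :=
  contDiffAt_const.clm_comp (contDiffAt_chartBi hP x₀)

omit [FiniteDimensional ℝ E] in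
theorem pullCov_chartCov (a : Form E M 1) {x₀ : M} {y : E}
    (hy : y ∈ (extChartAt 𝓘(ℝ, E) x₀).target) :
    pullCov x₀ y (chartCov a x₀ y) = covector a ((extChartAt 𝓘(ℝ, E) x₀).symm y) := by
  refine ContinuousLinearMap.ext fun v => ?_
  change toCov (chartForm a x₀ y) (chartDer x₀ y v) = (a ((extChartAt 𝓘(ℝ, E) x₀).symm y) : E [⋀^Fin 1]→L[ℝ] ℝ) fun _ => v
  rw [toCov_apply, chartForm_apply]
  congr 1
  funext i
  fin_cases i
  exact chartInv_chartDer hy v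

theorem chartVec_sharp (P : BiField E M) (a : Form E M 1) {x₀ : M} {y : E}
    (hy : y ∈ (extChartAt 𝓘(ℝ, E) x₀).target) :
    chartVec (sharp P a) x₀ y = chartSharp P x₀ y (chartCov a x₀ y) := by
  refine eq_of_forall_covector fun q => ?_
  rw [apply_chartSharp, chartBi_apply, pullCov_chartCov a hy]
  exact apply_sharp P a _ (pullCov x₀ y q)

omit [FiniteDimensional ℝ E] in
theorem chartCov_insertEnd (N : EndField E M) (a : Form E M 1) {x₀ : M} {y : E}
    (hy : y ∈ (extChartAt 𝓘(ℝ, E) x₀).target) :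
    chartCov (insertEnd N a) x₀ y = (chartCov a x₀ y).comp (chartEnd N x₀ y) := by
  ext v
  rw [chartCov, chartForm_insertEnd N a hy, toCov_insertEndAlt]
  rfl

omit [IsManifold 𝓘(ℝ, E) ∞ M] [FiniteDimensional ℝ E] in
theorem transpose_eq_insertEnd (N : EndField E M) (a : Form E M 1) :
    N.transpose a = insertEnd N a := by
  funext x
  refine ContinuousAlternatingMap.ext fun v => ?_
  refine Eq.trans ?_ (insertEndAlt_apply (N x) (a x) v).symm
  rw [Fin.sum_univ_one]
  refine congrArg (a x) (funext fun i => ?_)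
  fin_cases i
  rfl

omit [FiniteDimensional ℝ E] in
theorem chartVec_app (N : EndField E M) (X : VField E M) {x₀ : M} {y : E}
    (hy : y ∈ (extChartAt 𝓘(ℝ, E) x₀).target) :
    chartVec (N.app X) x₀ y = chartEnd N x₀ y (chartVec X x₀ y) := by
  have := chartInv_chartDer hy (X ((extChartAt 𝓘(ℝ, E) x₀).symm y))
  exact congrArg (fun w : E => chartDer x₀ y
    ((N ((extChartAt 𝓘(ℝ, E) x₀).symm y) : E →L[ℝ] E) w)) this.symm

theorem chartSharp_comp_chartEnd {P : BiField E M} {N : EndField E M}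
    (h : ∀ a : Form E M 1, N.app (sharp P a) = sharp P (N.transpose a)) {x₀ : M} {y : E}
    (hy : y ∈ (extChartAt 𝓘(ℝ, E) x₀).target) (p : E →L[ℝ] ℝ) :
    chartSharp P x₀ y (p.comp (chartEnd N x₀ y)) = chartEnd N x₀ y (chartSharp P x₀ y p) := by
  -- The commutation hypothesis covers all 1-forms, smooth or not, so any field with the right value
  -- at one point will do.
  let a : Form E M 1 := fun _ => ContinuousAlternatingMap.ofSubsingleton ℝ E ℝ (0 : Fin 1)
    (p.comp (chartDer x₀ y))
  have ha : chartCov a x₀ y = p := by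
    ext v
    rw [chartCov, toCov_apply, chartForm_apply]
    exact congrArg p (chartDer_chartInv hy v)
  have h1 := congrArg (fun X => chartVec X x₀ y) (h a)
  rw [chartVec_app _ _ hy, chartVec_sharp _ _ hy, chartVec_sharp _ _ hy, transpose_eq_insertEnd,
    chartCov_insertEnd _ _ hy, ha] at h1
  exact h1.symm

/-- The expression of `d_N a` in a chart, for a 1-form `a`. -/
theorem eventually_chartForm_dN {N : EndField E M} (hN : SmoothEndField N) {a : Form E M 1}
    (ha : SmoothAtPoints a) (x₀ : M) : ∀ᶠ y in 𝓝 (extChartAt 𝓘(ℝ, E) x₀ x₀), ∀ v,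
      chartForm (dN N a) x₀ y v = flatDN (chartEnd N x₀) (chartCov a x₀) y (v 0) (v 1) := by
  have e1 := ((ha x₀).of_le (m := 1) (by simp)).eventually (by simp)
  have e2 := ((contDiffAt_chartEnd hN x₀).of_le (m := 1) (by simp)).eventually (by simp)
  have e3 := (((ha.insertEnd hN) x₀).of_le (m := 1) (by simp)).eventually (by simp)
  filter_upwards [e1, e2, e3, target_mem_nhds x₀ (mem_extChartAt_target x₀)] with y h1 h2 h3 hy v
  have d1 : DifferentiableAt ℝ (chartCov a x₀) y :=
    (ContDiffAt.toCov h1).differentiableAt (by simp)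
  have d2 := h2.differentiableAt (by simp)
  have heq : (fun z => toCov (chartForm (insertEnd N a) x₀ z)) =ᶠ[𝓝 y]
      fun z => (chartCov a x₀ z).comp (chartEnd N x₀ z) := by
    filter_upwards [target_mem_nhds x₀ hy] with z hz using chartCov_insertEnd N a hz
  have hd : fderiv ℝ (fun z => toCov (chartForm (insertEnd N a) x₀ z)) y = _ :=
    (heq.fderiv_eq (𝕜 := ℝ)).trans (fderiv_clm_comp d1 d2)
  rw [dN, chartForm_sub, ContinuousAlternatingMap.sub_apply, chartForm_insertEnd _ _ hy,
    chartForm_extD ha hy, chartForm_extD (ha.insertEnd hN) hy, insertEndAlt_two,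
    extDeriv_one_form h1, extDeriv_one_form h1, extDeriv_one_form h3, hd]
  -- The terms `Da(u)(N v)` and `Da(v)(N u)` of `i_N da` cancel against `d(a ∘ N)`.
  simp [flatDN]
  change fderiv ℝ (chartCov a x₀) y _ _ - fderiv ℝ (chartCov a x₀) y _ _
    + (fderiv ℝ (chartCov a x₀) y _ _ - fderiv ℝ (chartCov a x₀) y _ _) - _ = _
  ring

theorem smoothAtPoints_interiorForm {X : VField E M} {a : Form E M 1}
    (hX : ∀ p, ContDiffAt ℝ ∞ (chartVec X p) (extChartAt 𝓘(ℝ, E) p p))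
    (ha : SmoothAtPoints a) : SmoothAtPoints (interiorForm X a) := fun p => by
  have h : ContDiffAt ℝ ∞ (fun y => interiorAlt (chartVec X p y) (chartForm a p y))
      (extChartAt 𝓘(ℝ, E) p p) := by
    refine contDiffAt_form fun m => ?_
    have : (fun y => interiorAlt (chartVec X p y) (chartForm a p y) m) =
        fun y => toCov (chartForm a p y) (chartVec X p y) := by
      funext y
      rw [interiorAlt_apply, apply_eq_toCov]
      rfl
    rw [this]
    exact (ContDiffAt.toCov (ha p)).clm_apply (hX p)
  refine h.congr_of_eventuallyEq ?_
  filter_upwards [target_mem_nhds p (mem_extChartAt_target p)] with y hy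
  exact chartForm_interior X a hy

theorem chartCov_extD_interiorForm {X : VField E M} {a : Form E M 1}
    (hX : ∀ p, ContDiffAt ℝ ∞ (chartVec X p) (extChartAt 𝓘(ℝ, E) p p))
    (ha : SmoothAtPoints a) {x₀ : M} {y : E} (hy : y ∈ (extChartAt 𝓘(ℝ, E) x₀).target)
    (dX : DifferentiableAt ℝ (chartVec X x₀) y) (da : ContDiffAt ℝ 1 (chartForm a x₀) y) (w : E) :
    chartCov (extD (interiorForm X a)) x₀ y w =
      fderiv ℝ (chartCov a x₀) y w (chartVec X x₀ y)
        + chartCov a x₀ y (fderiv ℝ (chartVec X x₀) y w) := by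
  have d1 : DifferentiableAt ℝ (chartCov a x₀) y :=
    (ContDiffAt.toCov da).differentiableAt (by simp)
  have hev : chartForm (interiorForm X a) x₀ =ᶠ[𝓝 y]
      fun z => interiorAlt (chartVec X x₀ z) (chartForm a x₀ z) := by
    filter_upwards [target_mem_nhds x₀ hy] with z hz using chartForm_interior X a hz
  have hval : ∀ z, interiorAlt (chartVec X x₀ z) (chartForm a x₀ z) ![] =
      chartCov a x₀ z (chartVec X x₀ z) := fun z => by
    rw [interiorAlt_apply, apply_eq_toCov]
    rfl
  have hdiff : DifferentiableAt ℝ (fun z => interiorAlt (chartVec X x₀ z) (chartForm a x₀ z)) y := by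
    have : (fun z => interiorAlt (chartVec X x₀ z) (chartForm a x₀ z)) = fun z =>
        (ContinuousAlternatingMap.constOfIsEmpty ℝ E (Fin 0)
          (chartCov a x₀ z (chartVec X x₀ z))) := by
      funext z
      ext m
      rw [Subsingleton.elim m ![], hval]
      rfl
    rw [this]
    exact ((ContinuousAlternatingMap.constOfIsEmptyLIE ℝ E ℝ (Fin 0)).toContinuousLinearEquiv.differentiableAt).comp y
      (d1.clm_apply dX)
  rw [chartCov, toCov_apply, chartForm_extD (smoothAtPoints_interiorForm hX ha) hy, hev.extDeriv_eq,
    extDeriv_zero_form hdiff]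
  simp only [hval]
  rw [fderiv_apply_apply d1 dX, add_comm]
  rfl

/-- The Lie derivative of a 1-form, in a chart. -/
theorem chartCov_lieForm {X : VField E M} {a : Form E M 1}
    (hX : ∀ p, ContDiffAt ℝ ∞ (chartVec X p) (extChartAt 𝓘(ℝ, E) p p))
    (ha : SmoothAtPoints a) {x₀ : M} {y : E} (hy : y ∈ (extChartAt 𝓘(ℝ, E) x₀).target)
    (dX : DifferentiableAt ℝ (chartVec X x₀) y) (da : ContDiffAt ℝ 1 (chartForm a x₀) y) (w : E) :
    chartCov (lieForm X a) x₀ y w =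
      fderiv ℝ (chartCov a x₀) y (chartVec X x₀ y) w
        + chartCov a x₀ y (fderiv ℝ (chartVec X x₀) y w) := by
  have h1 : chartCov (lieForm X a) x₀ y w = chartCov (interiorForm X (extD a)) x₀ y w
      + chartCov (extD (interiorForm X a)) x₀ y w := rfl
  have h2 : chartCov (interiorForm X (extD a)) x₀ y w =
      fderiv ℝ (chartCov a x₀) y (chartVec X x₀ y) w
        - fderiv ℝ (chartCov a x₀) y w (chartVec X x₀ y) := by
    rw [chartCov, chartForm_interior _ _ hy, toCov_interiorAlt, chartForm_extD ha hy,
      extDeriv_one_form da]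
    rfl
  -- The terms `Da(w)(X)` in the two halves of Cartan's formula cancel.
  rw [h1, h2, chartCov_extD_interiorForm hX ha hy dX da]
  ring

theorem contDiffAt_chartVec_sharp {P : BiField E M} (hP : SmoothBiField P) {a : Form E M 1}
    (ha : SmoothAtPoints a) (p : M) :
    ContDiffAt ℝ ∞ (chartVec (sharp P a) p) (extChartAt 𝓘(ℝ, E) p p) := by
  refine ContDiffAt.congr_of_eventuallyEq
    ((contDiffAt_chartSharp hP p).clm_apply (ContDiffAt.toCov (ha p))) ?_
  filter_upwards [target_mem_nhds p (mem_extChartAt_target p)] with y hy using chartVec_sharp P a hy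

/-- The bracket of 1-forms, in a chart. -/
theorem eventually_chartCov_koszul₁ {P : BiField E M} (hP : SmoothBiField P)
    (hskew : ∀ x a b, P x a b = -P x b a) {a b : Form E M 1} (ha : SmoothAtPoints a)
    (hb : SmoothAtPoints b) (x₀ : M) : ∀ᶠ y in 𝓝 (extChartAt 𝓘(ℝ, E) x₀ x₀),
      chartCov (koszul₁ P b a) x₀ y =
        flatBracket (chartSharp P x₀) (chartCov b x₀) (chartCov a x₀) y := by
  have e1 := ((ha x₀).of_le (m := 1) (by simp)).eventually (by simp)
  have e2 := ((hb x₀).of_le (m := 1) (by simp)).eventually (by simp)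
  have e3 := ((contDiffAt_chartSharp hP x₀).of_le (m := 1) (by simp)).eventually (by simp)
  filter_upwards [e1, e2, e3, target_mem_nhds x₀ (mem_extChartAt_target x₀)] with y h1 h2 h3 hy
  have da : DifferentiableAt ℝ (chartCov a x₀) y :=
    (ContDiffAt.toCov h1).differentiableAt (by simp)
  have db : DifferentiableAt ℝ (chartCov b x₀) y :=
    (ContDiffAt.toCov h2).differentiableAt (by simp)
  have dS := h3.differentiableAt (by simp)
  have hev : ∀ c : Form E M 1, chartVec (sharp P c) x₀ =ᶠ[𝓝 y]
      fun z => chartSharp P x₀ z (chartCov c x₀ z) := fun c => by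
    filter_upwards [target_mem_nhds x₀ hy] with z hz using chartVec_sharp P c hz
  have hdv : ∀ c : Form E M 1, DifferentiableAt ℝ (chartCov c x₀) y →
      DifferentiableAt ℝ (chartVec (sharp P c) x₀) y := fun c hc =>
    (dS.clm_apply hc).congr_of_eventuallyEq (hev c)
  have hfd : ∀ c : Form E M 1, DifferentiableAt ℝ (chartCov c x₀) y → ∀ w,
      fderiv ℝ (chartVec (sharp P c) x₀) y w = chartSharp P x₀ y (fderiv ℝ (chartCov c x₀) y w)
        + fderiv ℝ (chartSharp P x₀) y w (chartCov c x₀ y) := fun c hc w => by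
    rw [(hev c).fderiv_eq (𝕜 := ℝ), fderiv_apply_apply dS hc]
  have hX := fun c (hc : SmoothAtPoints c) => contDiffAt_chartVec_sharp hP hc
  have hsk := chartSharp_skew hskew x₀ y
  have hdsk := fderiv_skew dS (Eventually.of_forall (chartSharp_skew hskew x₀))
  ext w
  have h0 : chartCov (koszul₁ P b a) x₀ y w = chartCov (lieForm (sharp P b) a) x₀ y w
      - chartCov (lieForm (sharp P a) b) x₀ y w
      - chartCov (extD (interiorForm (sharp P b) a)) x₀ y w := rfl
  -- Skewness of `S` and of its derivative rewrites `b(D(S a) w)` as `-Da(w)(S b) - a(DS_w b)`,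
  -- which leaves the three terms of `flatBracket`.
  rw [h0, chartCov_lieForm (hX b hb) ha hy (hdv b db) h1,
    chartCov_lieForm (hX a ha) hb hy (hdv a da) h2,
    chartCov_extD_interiorForm (hX b hb) ha hy (hdv b db) h1, hfd a da, hfd b db,
    chartVec_sharp _ _ hy, chartVec_sharp _ _ hy, flatBracket_apply, map_add, map_add,
    hsk (fderiv ℝ (chartCov a x₀) y w) (chartCov b x₀ y),
    hdsk w (chartCov a x₀ y) (chartCov b x₀ y)]
  ring

theorem SmoothAtPoints.koszul₁ {P : BiField E M} (hP : SmoothBiField P)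
    (hskew : ∀ x a b, P x a b = -P x b a) {a b : Form E M 1} (ha : SmoothAtPoints a)
    (hb : SmoothAtPoints b) : SmoothAtPoints (koszul₁ P b a) := fun p => by
  refine contDiffAt_form fun m => ?_
  have hS := contDiffAt_chartSharp hP p
  have ca := ContDiffAt.toCov (ha p)
  have cb := ContDiffAt.toCov (hb p)
  have dS := hS.fderiv_right (m := ∞) (by simp)
  have dca := ca.fderiv_right (m := ∞) (by simp)
  have dcb := cb.fderiv_right (m := ∞) (by simp)
  have h : ContDiffAt ℝ ∞ (fun y => flatBracket (chartSharp P p) (chartCov b p) (chartCov a p) y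
      (m 0)) (extChartAt 𝓘(ℝ, E) p p) := by
    simp only [flatBracket_apply]
    exact (((dca.clm_apply (hS.clm_apply cb)).clm_apply contDiffAt_const).sub
      ((dcb.clm_apply (hS.clm_apply ca)).clm_apply contDiffAt_const)).add
      (ca.clm_apply ((dS.clm_apply contDiffAt_const).clm_apply cb))
  refine h.congr_of_eventuallyEq ?_
  filter_upwards [eventually_chartCov_koszul₁ hP hskew ha hb p] with y hy
  rw [← hy, apply_eq_toCov]
  rfl

end Sharp

/-! ### The compatibility condition in charts. -/

section Compatibility

variable {E : Type*} [NormedAddCommGroup E] [NormedSpace ℝ E] [FiniteDimensional ℝ E]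
variable {M : Type*} [TopologicalSpace M] [ChartedSpace E M] [IsManifold 𝓘(ℝ, E) ∞ M]

omit [FiniteDimensional ℝ E] in
theorem mdifferentiableAt_of_chartVec {X : VField E M} {x₀ : M} {y : E}
    (hy : y ∈ (extChartAt 𝓘(ℝ, E) x₀).target) (hX : DifferentiableAt ℝ (chartVec X x₀) y) :
    MDifferentiableAt 𝓘(ℝ, E) (𝓘(ℝ, E).prod 𝓘(ℝ, E))
      (fun x => (Bundle.TotalSpace.mk' E x (X x) : TangentBundle 𝓘(ℝ, E) M))
      ((extChartAt 𝓘(ℝ, E) x₀).symm y) := by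
  have hs := (extChartAt 𝓘(ℝ, E) x₀).map_target hy
  have hs' := hs
  rw [extChartAt_source] at hs'
  refine ((trivializationAt E (TangentSpace 𝓘(ℝ, E)) x₀).mdifferentiableAt_section_iff
    𝓘(ℝ, E) X hs').2 ?_
  have h1 : MDifferentiableAt 𝓘(ℝ, E) 𝓘(ℝ, E)
      (fun x => chartVec X x₀ (extChartAt 𝓘(ℝ, E) x₀ x)) ((extChartAt 𝓘(ℝ, E) x₀).symm y) := by
    refine MDifferentiableAt.comp (I' := 𝓘(ℝ, E)) ((extChartAt 𝓘(ℝ, E) x₀).symm y) (g := chartVec X x₀) ?_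
      (mdifferentiableAt_extChartAt hs')
    rw [(extChartAt 𝓘(ℝ, E) x₀).right_inv hy]
    exact hX.mdifferentiableAt
  refine h1.congr_of_eventuallyEq ?_
  filter_upwards [(isOpen_extChartAt_source (I := 𝓘(ℝ, E)) x₀).mem_nhds hs] with x hx
  have hx' := hx
  rw [extChartAt_source] at hx'
  have h2 := continuousLinearMapAt_eq_chartDer ((extChartAt 𝓘(ℝ, E) x₀).map_source hx)
  rw [chartVec, ← h2, (extChartAt 𝓘(ℝ, E) x₀).left_inv hx]
  exact (Bundle.Trivialization.continuousLinearMapAt_apply_of_mem ℝ _ hx' _).symm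

/-- The Lie bracket of vector fields, in a chart. -/
theorem chartVec_mlieBracket {X Y : VField E M} {x₀ : M} {y : E}
    (hy : y ∈ (extChartAt 𝓘(ℝ, E) x₀).target) (hX : DifferentiableAt ℝ (chartVec X x₀) y)
    (hY : DifferentiableAt ℝ (chartVec Y x₀) y) :
    chartVec (VectorField.mlieBracket 𝓘(ℝ, E) X Y) x₀ y =
      fderiv ℝ (chartVec Y x₀) y (chartVec X x₀ y)
        - fderiv ℝ (chartVec X x₀) y (chartVec Y x₀ y) := by
  have hpull : ∀ (Z : VField E M) {z : E}, z ∈ (extChartAt 𝓘(ℝ, E) x₀).target →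
      VectorField.mpullback 𝓘(ℝ, E) 𝓘(ℝ, E) (extChartAt 𝓘(ℝ, E) x₀).symm Z z =
        chartVec Z x₀ z := by
    intro Z z hz
    -- Thus `chartVec` is the pullback by the inverse chart, and naturality of the Lie bracket
    -- applies.
    have hinv : (chartInv x₀ z).inverse = chartDer x₀ z :=
      ContinuousLinearMap.inverse_eq (chartInv_comp_chartDer hz) (chartDer_comp_chartInv hz)
    exact congrArg (fun L : E →L[ℝ] E => L (Z ((extChartAt 𝓘(ℝ, E) x₀).symm z))) hinv
  have hev : ∀ Z : VField E M,
      VectorField.mpullback 𝓘(ℝ, E) 𝓘(ℝ, E) (extChartAt 𝓘(ℝ, E) x₀).symm Z =ᶠ[𝓝 y]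
        chartVec Z x₀ := fun Z => by
    filter_upwards [target_mem_nhds x₀ hy] with z hz using hpull Z hz
  have : IsManifold 𝓘(ℝ, E) (minSmoothness ℝ 2) M :=
    IsManifold.of_le (n := ∞) (by simpa using ENat.LEInfty.out)
  have : CompleteSpace E := FiniteDimensional.complete ℝ E
  have hsymm : ContMDiffAt 𝓘(ℝ, E) 𝓘(ℝ, E) ∞ (extChartAt 𝓘(ℝ, E) x₀).symm y :=
    (contMDiffOn_extChartAt_symm x₀).contMDiffAt (target_mem_nhds x₀ hy)
  have h := VectorField.mpullback_mlieBracket (mdifferentiableAt_of_chartVec hy hX)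
    (mdifferentiableAt_of_chartVec hy hY) hsymm (by simpa using ENat.LEInfty.out)
  have hE : ∀ V W : VField E E,
      VectorField.mlieBracket 𝓘(ℝ, E) V W y = VectorField.lieBracket ℝ V W y := fun V W => by
    rw [← VectorField.mlieBracketWithin_univ, VectorField.mlieBracketWithin_eq_lieBracketWithin]
    exact congrFun (VectorField.lieBracketWithin_univ (𝕜 := ℝ) (V := V) (W := W)) y
  exact (hpull _ hy).symm.trans (h.trans (((hev X).mlieBracket_vectorField_eq (hev Y)).trans
    (hE (chartVec X x₀) (chartVec Y x₀))))

omit [FiniteDimensional ℝ E] in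
theorem SmoothVField.contDiffAt_chartVec {X : VField E M} (hX : SmoothVField X) (p : M) :
    ContDiffAt ℝ ∞ (chartVec X p) (extChartAt 𝓘(ℝ, E) p p) := by
  refine (contDiffAt_comp_symm ((Bundle.contMDiffAt_section p).1 (hX p))).congr_of_eventuallyEq ?_
  filter_upwards [target_mem_nhds p (mem_extChartAt_target p)] with y hy
  have hs := (extChartAt 𝓘(ℝ, E) p).map_target hy
  rw [extChartAt_source] at hs
  rw [chartVec, ← continuousLinearMapAt_eq_chartDer hy]
  exact Bundle.Trivialization.continuousLinearMapAt_apply_of_mem ℝ _ hs _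

/-- The differential of a function, as a 1-form. -/
def differential (g : M → ℝ) : Form E M 1 :=
  extD (fun x => ContinuousAlternatingMap.constOfIsEmpty ℝ (TangentSpace 𝓘(ℝ, E) x) (Fin 0) (g x))

omit [FiniteDimensional ℝ E] in
theorem contDiffOn_comp_symm {g : M → ℝ} (hg : ContMDiff 𝓘(ℝ, E) 𝓘(ℝ, ℝ) ∞ g) (p : M) :
    ContDiffOn ℝ ∞ (fun y => g ((extChartAt 𝓘(ℝ, E) p).symm y)) (extChartAt 𝓘(ℝ, E) p).target := by
  rw [← contMDiffOn_iff_contDiffOn]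
  exact hg.comp_contMDiffOn (contMDiffOn_extChartAt_symm p)

omit [FiniteDimensional ℝ E] in
theorem chartForm_differential {g : M → ℝ} (hg : ContMDiff 𝓘(ℝ, E) 𝓘(ℝ, ℝ) ∞ g) {p : M} {y : E}
    (hy : y ∈ (extChartAt 𝓘(ℝ, E) p).target) (v : Fin 1 → E) :
    chartForm (differential g) p y v =
      fderiv ℝ (fun z => g ((extChartAt 𝓘(ℝ, E) p).symm z)) y (v 0) := by
  have h0 : ∀ q : M, chartForm (fun x => ContinuousAlternatingMap.constOfIsEmpty ℝ
      (TangentSpace 𝓘(ℝ, E) x) (Fin 0) (g x)) q = fun z =>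
      ContinuousAlternatingMap.constOfIsEmpty ℝ E (Fin 0) (g ((extChartAt 𝓘(ℝ, E) q).symm z)) :=
    fun q => rfl
  have hs : SmoothAtPoints (fun x => ContinuousAlternatingMap.constOfIsEmpty ℝ
      (TangentSpace 𝓘(ℝ, E) x) (Fin 0) (g x)) := fun q => by
    rw [h0]
    exact (ContinuousAlternatingMap.constOfIsEmptyLIE ℝ E ℝ (Fin 0)).toContinuousLinearEquiv.contDiff.contDiffAt.comp _
      ((contDiffOn_comp_symm hg q).contDiffAt (target_mem_nhds q (mem_extChartAt_target q)))
  rw [differential, chartForm_extD hs hy, h0, extDeriv_constOfIsEmpty]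
  rfl

theorem smoothForm_differential {g : M → ℝ} (hg : ContMDiff 𝓘(ℝ, E) 𝓘(ℝ, ℝ) ∞ g) :
    SmoothForm (differential (E := E) g) := fun p y hy => by
  refine ContDiffAt.contDiffWithinAt (contDiffAt_form fun v => ?_)
  have h := ((contDiffOn_comp_symm hg p).contDiffAt (target_mem_nhds p hy)).fderiv_right
    (m := ∞) (by simp)
  refine (h.clm_apply (contDiffAt_const (c := v 0))).congr_of_eventuallyEq ?_
  filter_upwards [target_mem_nhds p hy] with z hz using chartForm_differential hg hz v

variable [T2Space M]

omit [FiniteDimensional ℝ E] [IsManifold 𝓘(ℝ, E) ∞ M] [T2Space M] in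
theorem tendsto_extChartAt_symm (x₀ : M) :
    Tendsto (extChartAt 𝓘(ℝ, E) x₀).symm (𝓝 (extChartAt 𝓘(ℝ, E) x₀ x₀)) (𝓝 x₀) := by
  have := continuousAt_extChartAt_symm (I := 𝓘(ℝ, E)) x₀
  rwa [ContinuousAt, extChartAt_to_inv] at this

/-- Near a point, every covector is locally the constant coordinate expression of a global smooth
1-form. -/
theorem eventually_exists_smoothForm_chartCov_eq (x₀ : M) :
    ∀ᶠ y in 𝓝 (extChartAt 𝓘(ℝ, E) x₀ x₀), ∀ p : E →L[ℝ] ℝ,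
      ∃ a : Form E M 1, SmoothForm a ∧ ∀ᶠ z in 𝓝 y, chartCov a x₀ z = p := by
  obtain ⟨χ⟩ : Nonempty (SmoothBumpFunction 𝓘(ℝ, E) x₀) := inferInstance
  have h1 : ∀ᶠ y in 𝓝 (extChartAt 𝓘(ℝ, E) x₀ x₀),
      χ ((extChartAt 𝓘(ℝ, E) x₀).symm y) = 1 :=
    (tendsto_extChartAt_symm x₀).eventually χ.eventuallyEq_one
  filter_upwards [(h1.and (target_mem_nhds x₀ (mem_extChartAt_target x₀))).eventually_nhds]
    with y hy p
  have hg : ContMDiff 𝓘(ℝ, E) 𝓘(ℝ, ℝ) ∞ fun x => χ x • p (extChartAt 𝓘(ℝ, E) x₀ x) :=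
    χ.contMDiff_smul (p.contMDiff.comp_contMDiffOn contMDiffOn_extChartAt)
  -- Where `χ = 1` this function is linear in the coordinates, so its differential is the constant
  -- `p`.
  refine ⟨differential fun x => χ x • p (extChartAt 𝓘(ℝ, E) x₀ x), smoothForm_differential hg, ?_⟩
  filter_upwards [hy.eventually_nhds] with y hy
  have heq : (fun z => χ ((extChartAt 𝓘(ℝ, E) x₀).symm z) •
      p (extChartAt 𝓘(ℝ, E) x₀ ((extChartAt 𝓘(ℝ, E) x₀).symm z))) =ᶠ[𝓝 y] p := by
    filter_upwards [hy] with z hz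
    rw [hz.1, one_smul, (extChartAt 𝓘(ℝ, E) x₀).right_inv hz.2]
  ext v
  rw [chartCov, toCov_apply, chartForm_differential hg hy.self_of_nhds.2,
    heq.fderiv_eq (𝕜 := ℝ), p.fderiv]
  rfl

/-- Near a point, every vector is locally the constant coordinate expression of a global smooth
vector field. -/
theorem eventually_exists_smoothVField_chartVec_eq (x₀ : M) :
    ∀ᶠ y in 𝓝 (extChartAt 𝓘(ℝ, E) x₀ x₀), ∀ u : E,
      ∃ X : VField E M, SmoothVField X ∧ ∀ᶠ z in 𝓝 y, chartVec X x₀ z = u := by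
  obtain ⟨χ⟩ : Nonempty (SmoothBumpFunction 𝓘(ℝ, E) x₀) := inferInstance
  have h1 : ∀ᶠ y in 𝓝 (extChartAt 𝓘(ℝ, E) x₀ x₀),
      χ ((extChartAt 𝓘(ℝ, E) x₀).symm y) = 1 :=
    (tendsto_extChartAt_symm x₀).eventually χ.eventuallyEq_one
  filter_upwards [(h1.and (target_mem_nhds x₀ (mem_extChartAt_target x₀))).eventually_nhds]
    with y hy u
  let e := trivializationAt E (TangentSpace 𝓘(ℝ, E) (M := M)) x₀
  let s : VField E M := fun x => e.symmL ℝ x u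
  have hs : ContMDiffOn 𝓘(ℝ, E) (𝓘(ℝ, E).prod 𝓘(ℝ, E)) ∞
      (fun x => (Bundle.TotalSpace.mk' E x (s x) : TangentBundle 𝓘(ℝ, E) M)) e.baseSet := by
    refine e.contMDiffOn_section_baseSet_iff.2 ((contMDiffOn_const (c := u)).congr fun x hx => ?_)
    rw [← e.continuousLinearMapAt_apply_of_mem ℝ hx]
    exact e.continuousLinearMapAt_symmL hx u
  -- The section with constant value `u` in the trivialization, cut off by `χ` to become global.
  refine ⟨(χ : M → ℝ) • s, ContMDiffOn.smul_section_of_tsupport χ.contMDiff.contMDiffOn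
    e.open_baseSet χ.tsupport_subset_chartAt_source hs, ?_⟩
  filter_upwards [hy] with y hy
  have h1 : (((χ : M → ℝ) • s) ((extChartAt 𝓘(ℝ, E) x₀).symm y) : E) = chartInv x₀ y u := by
    rw [← symmL_eq_chartInv hy.2]
    change χ _ • s _ = _
    rw [hy.1]
    exact one_smul ℝ _
  rw [chartVec]
  exact (congrArg (chartDer x₀ y) h1).trans (chartDer_chartInv hy.2 u)

omit [FiniteDimensional ℝ E] [T2Space M] in
theorem contDiffAt_chartVec_app {N : EndField E M} (hN : SmoothEndField N) {X : VField E M}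
    (hX : SmoothVField X) (p : M) :
    ContDiffAt ℝ ∞ (chartVec (N.app X) p) (extChartAt 𝓘(ℝ, E) p p) := by
  refine ((contDiffAt_chartEnd hN p).clm_apply (hX.contDiffAt_chartVec p)).congr_of_eventuallyEq ?_
  filter_upwards [target_mem_nhds p (mem_extChartAt_target p)] with y hy using chartVec_app N X hy

/-- The compatibility of `P` and `N`, in a chart. -/
theorem Compatible.eventually_flatCompatibleAt {P : BiField E M} {N : EndField E M}
    (hP : SmoothBiField P) (hN : SmoothEndField N) (h : Compatible P N) (x₀ : M) :
    ∀ᶠ y in 𝓝 (extChartAt 𝓘(ℝ, E) x₀ x₀),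
      FlatCompatibleAt (chartSharp P x₀) (chartEnd N x₀) y := by
  have e1 := ((contDiffAt_chartSharp hP x₀).of_le (m := 1) (by simp)).eventually (by simp)
  have e2 := ((contDiffAt_chartEnd hN x₀).of_le (m := 1) (by simp)).eventually (by simp)
  filter_upwards [e1, e2, target_mem_nhds x₀ (mem_extChartAt_target x₀),
    eventually_exists_smoothForm_chartCov_eq x₀, eventually_exists_smoothVField_chartVec_eq x₀]
    with y h1 h2 hy hform hvec p u
  -- For fields constant in coordinates near `y`, the derivatives of `a` and `X` drop out and only
  -- those of `S` and `N` remain.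
  obtain ⟨a, ha, hap⟩ := hform p
  obtain ⟨X, hX, hXu⟩ := hvec u
  have dS := h1.differentiableAt (by simp)
  have dN := h2.differentiableAt (by simp)
  have hev : ∀ᶠ z in 𝓝 y, z ∈ (extChartAt 𝓘(ℝ, E) x₀).target := target_mem_nhds x₀ hy
  have hSa : chartVec (sharp P a) x₀ =ᶠ[𝓝 y] fun z => chartSharp P x₀ z p := by
    filter_upwards [hev, hap] with z hz hz'
    rw [chartVec_sharp P a hz, hz']
  have hNX : chartVec (N.app X) x₀ =ᶠ[𝓝 y] fun z => chartEnd N x₀ z u := by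
    filter_upwards [hev, hXu] with z hz hz'
    rw [chartVec_app N X hz, hz']
  have hX' : chartVec X x₀ =ᶠ[𝓝 y] fun _ => u := hXu
  have ha' : chartCov a x₀ =ᶠ[𝓝 y] fun _ => p := hap
  have hNa : chartCov (insertEnd N a) x₀ =ᶠ[𝓝 y] fun z => p.comp (chartEnd N x₀ z) := by
    filter_upwards [hev, hap] with z hz hz'
    rw [chartCov_insertEnd N a hz, hz']
  have hsa := ha.smoothAtPoints
  have cform : ∀ {b : Form E M 1}, ContDiffAt ℝ 1 (chartCov b x₀) y →
      ContDiffAt ℝ 1 (chartForm b x₀) y := fun {b} hb => contDiffAt_form fun m => by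
    simp only [apply_eq_toCov]
    exact hb.clm_apply contDiffAt_const
  have ca : ContDiffAt ℝ 1 (chartForm a x₀) y := cform (contDiffAt_const.congr_of_eventuallyEq ha')
  have cNa : ContDiffAt ℝ 1 (chartForm (insertEnd N a) x₀) y :=
    cform ((contDiffAt_const.clm_comp h2).congr_of_eventuallyEq hNa)
  have dX : DifferentiableAt ℝ (chartVec X x₀) y :=
    (differentiableAt_const u).congr_of_eventuallyEq hX'
  have dNX : DifferentiableAt ℝ (chartVec (N.app X) x₀) y :=
    (dN.clm_apply (differentiableAt_const u)).congr_of_eventuallyEq hNX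
  have dSa : DifferentiableAt ℝ (chartVec (sharp P a) x₀) y :=
    (dS.clm_apply (differentiableAt_const p)).congr_of_eventuallyEq hSa
  have hlie := congrArg (fun Y => chartVec Y x₀ y) (h.lie a X ha hX)
  have hsplit : ∀ A B C D : VField E M, chartVec ((A - B) - C + D) x₀ y =
      chartVec A x₀ y - chartVec B x₀ y - chartVec C x₀ y + chartVec D x₀ y := fun A B C D => by
    have : ∀ L : E →L[ℝ] E, ∀ A B C D : E, L ((A - B) - C + D) = L A - L B - L C + L D :=
      fun L A B C D => by rw [map_add, map_sub, map_sub]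
    exact this (chartDer x₀ y) _ _ _ _
  have hzero : chartVec (0 : VField E M) x₀ y = 0 := (chartDer x₀ y).map_zero
  simp only [hsplit, hzero] at hlie
  rw [chartVec_mlieBracket hy dSa dNX, chartVec_app N (VectorField.mlieBracket _ _ _) hy,
    chartVec_mlieBracket hy dSa dX,
    chartVec_sharp P (lieForm X _) hy, chartVec_sharp P (lieForm (N.app X) _) hy,
    transpose_eq_insertEnd, hSa.fderiv_eq (𝕜 := ℝ), hNX.fderiv_eq (𝕜 := ℝ), hX'.fderiv_eq (𝕜 := ℝ),
    hSa.eq_of_nhds, hNX.eq_of_nhds, hX'.eq_of_nhds, fderiv_apply_const dS,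
    fderiv_apply_const dN] at hlie
  have hl1 : chartCov (lieForm X (insertEnd N a)) x₀ y = p.comp (fderiv ℝ (chartEnd N x₀) y u) := by
    ext w
    rw [chartCov_lieForm hX.contDiffAt_chartVec (hsa.insertEnd hN) hy dX cNa,
      hNa.fderiv_eq (𝕜 := ℝ), hX'.fderiv_eq (𝕜 := ℝ), hX'.eq_of_nhds,
      fderiv_clm_comp (differentiableAt_const p) dN]
    simp
  have hl2 : chartCov (lieForm (N.app X) a) x₀ y =
      p.comp ((fderiv ℝ (chartEnd N x₀) y).flip u) := by
    ext w
    rw [chartCov_lieForm (contDiffAt_chartVec_app hN hX) hsa hy dNX ca,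
      ha'.fderiv_eq (𝕜 := ℝ), hNX.fderiv_eq (𝕜 := ℝ), ha'.eq_of_nhds, fderiv_apply_const dN]
    simp
  rw [hl1, hl2] at hlie
  simpa [sub_neg_eq_add, fderiv_apply_const dS] using hlie

end Compatibility

/-! ### `d_N` of the bracket on the manifold, and the final assembly. -/

section Main

variable {E : Type*} [NormedAddCommGroup E] [NormedSpace ℝ E] [FiniteDimensional ℝ E]
variable {M : Type*} [TopologicalSpace M] [ChartedSpace E M] [IsManifold 𝓘(ℝ, E) ∞ M]

/-- If `d_N a = a ∧ c` and `d_N b = b ∧ c`, then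
`d_N [b, a] = 2 [b, a] ∧ c + a ∧ [b, c] - b ∧ [a, c]`. -/
theorem dN_koszul₁ [T2Space M] {P : BiField E M} {N : EndField E M} (hP : SmoothBiField P)
    (hskew : ∀ x a b, P x a b = -P x b a) (hN : SmoothEndField N) (hPN : Compatible P N)
    {a b c : Form E M 1} (ha : SmoothAtPoints a) (hb : SmoothAtPoints b) (hc : SmoothAtPoints c)
    (hda : dN N a = a ⋏ c) (hdb : dN N b = b ⋏ c) :
    dN N (koszul₁ P b a) = (2 : ℝ) • (koszul₁ P b a ⋏ c) + a ⋏ koszul₁ P b c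
      - b ⋏ koszul₁ P a c := by
  refine form_ext fun x v => ?_
  have hx := mem_extChartAt_target (I := 𝓘(ℝ, E)) x
  have flatten : ∀ e : Form E M 1, SmoothAtPoints e → dN N e = e ⋏ c →
      ∀ᶠ y in 𝓝 (extChartAt 𝓘(ℝ, E) x x), ∀ u v, flatDN (chartEnd N x) (chartCov e x) y u v =
        chartCov e x y u * chartCov c x y v - chartCov e x y v * chartCov c x y u := by
    intro e he hde
    filter_upwards [eventually_chartForm_dN hN he x] with y hy u v
    have h := hy ![u, v]
    rw [hde, chartForm_wedge, wedgeAlt_one_one] at h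
    exact h.symm
  have hκ : chartCov (koszul₁ P b a) x =ᶠ[𝓝 (extChartAt 𝓘(ℝ, E) x x)]
      flatBracket (chartSharp P x) (chartCov b x) (chartCov a x) :=
    eventually_chartCov_koszul₁ hP hskew ha hb x
  have key := flatDN_flatBracket (contDiffAt_chartSharp hP x) (contDiffAt_chartEnd hN x)
    (ContDiffAt.toCov (ha x)) (ContDiffAt.toCov (hb x)) (ContDiffAt.toCov (hc x))
    (Eventually.of_forall (chartSharp_skew hskew x))
    (fun p => chartSharp_comp_chartEnd hPN.comm hx p)
    (hPN.eventually_flatCompatibleAt hP hN x) (flatten a ha hda) (flatten b hb hdb) (v 0) (v 1)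
  -- `d_N` involves a first derivative, so the coordinate formula for the bracket is needed near the
  -- point, as `hκ` provides.
  have hflat : flatDN (chartEnd N x) (chartCov (koszul₁ P b a) x) (extChartAt 𝓘(ℝ, E) x x) =
      flatDN (chartEnd N x) (flatBracket (chartSharp P x) (chartCov b x) (chartCov a x))
        (extChartAt 𝓘(ℝ, E) x x) := by
    funext u v
    rw [flatDN, flatDN, hκ.fderiv_eq (𝕜 := ℝ), hκ.eq_of_nhds]
  have hbr : ∀ e f : Form E M 1, SmoothAtPoints e → SmoothAtPoints f →
      flatBracket (chartSharp P x) (chartCov e x) (chartCov f x) (extChartAt 𝓘(ℝ, E) x x) =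
        chartCov (koszul₁ P e f) x (extChartAt 𝓘(ℝ, E) x x) := fun e f he hf =>
    (eventually_chartCov_koszul₁ hP hskew hf he x).self_of_nhds.symm
  rw [(eventually_chartForm_dN hN (ha.koszul₁ hP hskew hb) x).self_of_nhds v, hflat]
  refine key.trans ?_
  change _ * (flatBracket _ (chartCov b x) (chartCov a x) _ _ * chartCov c x _ _ -
    flatBracket _ (chartCov b x) (chartCov a x) _ _ * chartCov c x _ _) +
    (chartCov a x _ _ * flatBracket _ (chartCov b x) (chartCov c x) _ _ -
      chartCov a x _ _ * flatBracket _ (chartCov b x) (chartCov c x) _ _) -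
    (chartCov b x _ _ * flatBracket _ (chartCov a x) (chartCov c x) _ _ -
      chartCov b x _ _ * flatBracket _ (chartCov a x) (chartCov c x) _ _) = _
  rw [hbr b a hb ha, hbr b c hb hc, hbr a c ha hc, chartForm_sub, chartForm_add, chartForm_smul,
    chartForm_wedge, chartForm_wedge, chartForm_wedge, ContinuousAlternatingMap.sub_apply,
    ContinuousAlternatingMap.add_apply, ContinuousAlternatingMap.smul_apply, wedgeAlt_one_one,
    wedgeAlt_one_one, wedgeAlt_one_one, smul_eq_mul]
  rfl

omit [FiniteDimensional ℝ E] [IsManifold 𝓘(ℝ, E) ∞ M] in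
theorem insertEnd_add {k : ℕ} (N : EndField E M) (a b : Form E M k) :
    insertEnd N (a + b) = insertEnd N a + insertEnd N b := by
  funext x
  refine ContinuousAlternatingMap.ext fun v => ?_
  refine (insertEndAlt_apply _ _ _).trans ?_
  refine Eq.trans ?_ (congrArg₂ (· + ·) (insertEndAlt_apply (N x) (a x) v).symm
    (insertEndAlt_apply (N x) (b x) v).symm)
  rw [← Finset.sum_add_distrib]
  rfl

omit [FiniteDimensional ℝ E] [IsManifold 𝓘(ℝ, E) ∞ M] in
theorem insertEnd_smul {k : ℕ} (N : EndField E M) (r : ℝ) (a : Form E M k) :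
    insertEnd N (r • a) = r • insertEnd N a := by
  funext x
  refine ContinuousAlternatingMap.ext fun v => ?_
  refine (insertEndAlt_apply _ _ _).trans ?_
  refine Eq.trans ?_ (congrArg (r • ·) (insertEndAlt_apply (N x) (a x) v).symm)
  rw [Finset.smul_sum]
  rfl

theorem dN_add {N : EndField E M} (hN : SmoothEndField N) {a b : Form E M 1}
    (ha : SmoothAtPoints a) (hb : SmoothAtPoints b) : dN N (a + b) = dN N a + dN N b := by
  rw [dN, dN, dN, extD_add ha hb, insertEnd_add, insertEnd_add,
    extD_add (ha.insertEnd hN) (hb.insertEnd hN)]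
  abel

theorem dN_smul {N : EndField E M} (hN : SmoothEndField N) (r : ℝ) {a : Form E M 1}
    (ha : SmoothAtPoints a) : dN N (r • a) = r • dN N a := by
  rw [dN, dN, extD_smul r ha, insertEnd_smul, insertEnd_smul, extD_smul r (ha.insertEnd hN),
    smul_sub]

end Main

end PoissonGeom

end

theorem mainTheorem3
    {E : Type*} [NormedAddCommGroup E] [NormedSpace ℝ E] [FiniteDimensional ℝ E]
    {M : Type*} [TopologicalSpace M] [ChartedSpace E M] [IsManifold 𝓘(ℝ, E) ∞ M]
    [T2Space M] [SecondCountableTopology M]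
    (P : BiField E M) (hP : IsPoisson P)
    (N : EndField E M) (hN : SmoothEndField N) (hPN : Compatible P N)
    (α β γ : Form E M 1) (hα : SmoothForm α) (hβ : SmoothForm β) (hγ : SmoothForm γ)
    (hdα : dN N α = α ⋏ γ) (hdβ : dN N β = β ⋏ γ)
    (δ : Form E M 1) (hδ : δ = β + (1 / 2 : ℝ) • koszul₁ P β α)
    (Ω : Form E M 2) (hΩ : Ω = α ⋏ δ)
    (ε : Form E M 2)
    (hε : ε = (2 : ℝ) • (γ ⋏ β) + (3 / 2 : ℝ) • (γ ⋏ koszul₁ P β α)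
      + (1 / 2 : ℝ) • (β ⋏ koszul₁ P α γ) + koszul₁ P δ α ⋏ δ) :
    dN N Ω + (1 / 2 : ℝ) • koszul P Ω Ω = α ⋏ ε := by
  have hα' := hα.smoothAtPoints
  have hβ' := hβ.smoothAtPoints
  have hγ' := hγ.smoothAtPoints
  have hκ := hα'.koszul₁ hP.smooth hP.skew hβ'
  have hδ' : SmoothAtPoints δ := by
    rw [hδ]
    exact hβ'.add (hκ.smul _)
  have hdδ : dN N δ = β ⋏ γ + (1 / 2 : ℝ) • ((2 : ℝ) • (koszul₁ P β α ⋏ γ)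
      + α ⋏ koszul₁ P β γ - β ⋏ koszul₁ P α γ) := by
    rw [hδ, dN_add hN hβ' (hκ.smul _), dN_smul hN _ hκ, hdβ,
      dN_koszul₁ hP.smooth hP.skew hN hPN hα' hβ' hγ' hdα hdβ]
  have hdΩ : dN N Ω = (α ⋏ γ) ⋏ δ - α ⋏ dN N δ := by
    rw [hΩ, dN_wedge_one_one hN hα' hδ', hdα]
  have hΩΩ : (1 / 2 : ℝ) • koszul P Ω Ω = α ⋏ (koszul₁ P δ α ⋏ δ) := by
    rw [hΩ]
    exact koszul_self_of_decomposable hP.skew hα' hδ'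
  rw [hdΩ, hΩΩ, hdδ, hε]
  funext x
  refine ContinuousAlternatingMap.ext fun v => ?_
  have hδx : ∀ u, toCov (δ x) u = toCov (β x) u + 1 / 2 * toCov (koszul₁ P β α x) u := by
    intro u
    rw [hδ]
    rfl
  have e1 := wedgeAlt_two_one (wedgeAlt (α x) (γ x)) (δ x) v
  have e2 := wedgeAlt_one_two (α x) (wedgeAlt (β x) (γ x) + (1 / 2 : ℝ) •
    ((2 : ℝ) • wedgeAlt (koszul₁ P β α x) (γ x) + wedgeAlt (α x) (koszul₁ P β γ x)
      - wedgeAlt (β x) (koszul₁ P α γ x))) v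
  have e3 := wedgeAlt_one_two (α x) (wedgeAlt (koszul₁ P δ α x) (δ x)) v
  have e4 := wedgeAlt_one_two (α x) ((2 : ℝ) • wedgeAlt (γ x) (β x)
    + (3 / 2 : ℝ) • wedgeAlt (γ x) (koszul₁ P β α x)
    + (1 / 2 : ℝ) • wedgeAlt (β x) (koszul₁ P α γ x) + wedgeAlt (koszul₁ P δ α x) (δ x)) v
  refine Eq.trans ?_ e4.symm
  refine (congrArg₂ (· + ·) (congrArg₂ (· - ·) e1 e2) e3).trans ?_
  -- Under `α ∧ ·` the term `½ α ∧ [β, γ]` of `d_N δ` vanishes. The coefficients arise as `2 = 1 +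
  -- 1` and `3/2 = 1/2 + 1`, from `γ ∧ δ` and from `-d_N δ`.
  simp only [ContinuousAlternatingMap.add_apply, ContinuousAlternatingMap.sub_apply,
    ContinuousAlternatingMap.smul_apply, wedgeAlt_one_one, hδx, smul_eq_mul,
    Matrix.cons_val_zero, Matrix.cons_val_one]
  ring
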